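/- Proposition 3 (Selmer $S$-adic sequences). Let $\mathcal{A}=\{1,2,3\}$ and let $s_1,s_2$ be the substitutions (morphisms of the free monoid $\mathcal{A}^*$) \[ s_1:\ 1\mapsto 2,\ 2\mapsto 1,\ 3\mapsto 31,\qquad s_2:\ 1\mapsto 3,\ 2\mapsto 12,\ 3\mapsto 1 . \] On $\Gamma=\{(x_1,x_2,x_3)\in\mathbb{R}^3_{\ge 0} : \max(x_2,x_3)\le x_1\le x_2+x_3\}$ let the semi-sorted Selmer algorithm $F_S:\Gamma\to\Gamma$ be given by $F_S(x_1,x_2,x_3)=(x_2,\,x_1-x_3,\,x_3)$ if $x_2\ge x_3$ and $F_S(x_1,x_2,x_3)=(x_3,\,x_2,\,x_1-x_2)$ if $x_2<x_3$, and put $\sigma(\mathbf{x})=s_1$ if $x_2\ge x_3$ and $\sigma(\mathbf{x})=s_2$ if $x_2<x_3$. Let $\mathbf{x}=(x_1,x_2,x_3)\in\Gamma$ be totally irrational, that is, let $x_1,x_2,x_3$ be linearly independent over $\mathbb{Q}$, and let $\tau_n=\sigma(F_S^n(\mathbf{x}))$ for $n\ge 0$. Call an infinite word $\mathbf{w}\in\mathcal{A}^{\mathbb{N}}$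 an $S$-adic word with directive sequence $(\tau_n)_{n\ge 0}$ if there is a sequence of letters $(a_n)_{n\ge 0}$ with $\mathbf{w}=\lim_{n\to\infty}\tau_0\tau_1\cdots\tau_{n-1}(a_n)$, where the limit means that every prefix of $\mathbf{w}$ is a prefix of $\tau_0\tau_1\cdots\tau_{n-1}(a_n)$ for all sufficiently large $n$. Then there is an $S$-adic word with directive sequence $(\tau_n)_{n\ge 0}$, and every such word has factor complexity $p(n)=2n+1$: for every $n\ge 0$ it has exactly $2n+1$ distinct factors of length $n$. -/

import Mathlib

open Filter

namespace Selmer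

/-- A substitution (endomorphism of the free monoid of words over the alphabet `A`), given by the
images of the letters. -/
abbrev Substitution (A : Type*) := A → List A

/-- The image of a finite word under a substitution. -/
def Substitution.apply {A : Type*} (σ : Substitution A) (u : List A) : List A := u.flatMap σ

/-- `compose τ n u` is the finite word `τ 0 (τ 1 (⋯ (τ (n - 1) u)))`. -/
def compose {A : Type*} (τ : ℕ → Substitution A) : ℕ → List A → List A
  | 0, u => u
  | n + 1, u => compose τ n ((τ n).apply u)

/-- The prefix of length `k` of an infinite word. -/
def takePrefix {A : Type*} (w : ℕ → A) (k : ℕ) : List A := (List.range k).map w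

/-- The finite words `u n` converge to the infinite word `w`: every prefix of `w` is a prefix of
`u n` for all large `n`. -/
def ConvergesTo {A : Type*} (u : ℕ → List A) (w : ℕ → A) : Prop :=
  ∀ k : ℕ, ∀ᶠ n in atTop, takePrefix w k <+: u n

/-- `w` is an `S`-adic word with directive sequence `τ`: for some sequence of letters `a`,
`w` is the limit of the words `τ 0 (τ 1 (⋯ (τ (n - 1) (a n))))`. -/
def IsSAdicWord {A : Type*} (τ : ℕ → Substitution A) (w : ℕ → A) : Prop :=
  ∃ a : ℕ → A, ConvergesTo (fun n => compose τ n [a n]) w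

/-- `u` is a factor of the infinite word `w`. -/
def IsFactor {A : Type*} (w : ℕ → A) (u : List A) : Prop :=
  ∃ i : ℕ, (List.range u.length).map (fun j => w (i + j)) = u

/-- The factor complexity of `w`: the number of factors of length `n`. -/
noncomputable def complexity {A : Type*} (w : ℕ → A) (n : ℕ) : ℕ :=
  Set.ncard {u : List A | IsFactor w u ∧ u.length = n}

/-! The letters and the coordinates `1, 2, 3` are the elements `0, 1, 2` of `Fin 3`. -/

/-- The substitution `1 ↦ 2, 2 ↦ 1, 3 ↦ 31`. -/
def s₁ : Substitution (Fin 3) := ![[1], [0], [2, 0]]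

/-- The substitution `1 ↦ 3, 2 ↦ 12, 3 ↦ 1`. -/
def s₂ : Substitution (Fin 3) := ![[2], [0, 1], [0]]

/-- The cone of nonnegative vectors with `max (x₂, x₃) ≤ x₁ ≤ x₂ + x₃`. -/
def Gamma : Set (Fin 3 → ℝ) :=
  {x | (∀ i, 0 ≤ x i) ∧ max (x 1) (x 2) ≤ x 0 ∧ x 0 ≤ x 1 + x 2}

/-- One step of the semi-sorted Selmer algorithm. -/
noncomputable def FS (x : Fin 3 → ℝ) : Fin 3 → ℝ :=
  if x 2 ≤ x 1 then ![x 1, x 0 - x 2, x 2] else ![x 2, x 1, x 0 - x 1]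

/-- The algorithm maps the cone to itself. -/
theorem mapsTo_FS : Set.MapsTo FS Gamma Gamma := by
  rintro x ⟨h0, h1, h2⟩
  have a := h0 1
  have b := h0 2
  obtain ⟨c, d⟩ := max_le_iff.1 h1
  unfold FS Gamma
  split_ifs with h
  · refine ⟨fun i => ?_, max_le ?_ ?_, ?_⟩
    · fin_cases i <;> simp <;> linarith
    all_goals simp; linarith
  · refine ⟨fun i => ?_, max_le ?_ ?_, ?_⟩
    · fin_cases i <;> simp <;> linarith
    all_goals simp; linarith

/-- The substitution attached to `x`: `s₁` if `x₂ ≥ x₃`, and `s₂` if `x₂ < x₃`. -/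
noncomputable def subst (x : Fin 3 → ℝ) : Substitution (Fin 3) :=
  if x 2 ≤ x 1 then s₁ else s₂

/-- The directive sequence that the algorithm produces from `x`. -/
noncomputable def directive (x : Fin 3 → ℝ) (n : ℕ) : Substitution (Fin 3) :=
  subst (FS^[n] x)

end Selmer

/-! Total irrationality enters only through the directive sequence: it rules out a tail made of
blocks `s₁ s₁` and `s₂ s₂` (`good_directive`). Along such a tail `x₂ + x₃ - x₁` is constant and `x₁`
drops by at least that amount every two steps, so the constant is zero, a rational relation. The
rest is combinatorics of `Good` sequences.

Goodness makes every letter occur in every sufficiently deep image of a letter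
(`Good.exists_forall_mem_compose`). Hence all `S`-adic words with the same directive sequence have
the same factors, namely `Lang τ` (`IsSAdicWord.isFactor_iff`), and counting concerns `Lang τ`
alone.

Exactly five pairs of letters are adjacent (`Good.lang_pair_iff`), so a nonempty word has at most
two left extensions. The core is `Good.uniqueRight`: if a nonempty `u` can be preceded by both `a`
and `b`, then exactly one letter `c` keeps `a u c` and `b u c` in the language. It is proved by
desubstitution, passing to a shorter word for the shifted sequence. Every left special word
therefore extends to exactly one left special word of the next length. There are two of length one,
hence two of each positive length, and each contributes one to `p (n + 1) - p n`; with `p 1 = 3`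
this gives `2 n + 1`. -/

namespace Selmer

/-! ### Iterated substitutions -/

section General

variable {A : Type*}

/-- The directive sequence with its first term removed. -/
def shift (τ : ℕ → Substitution A) : ℕ → Substitution A := fun n => τ (n + 1)

theorem Substitution.apply_append (σ : Substitution A) (u v : List A) :
    σ.apply (u ++ v) = σ.apply u ++ σ.apply v := List.flatMap_append

theorem Substitution.apply_cons (σ : Substitution A) (a : A) (v : List A) :
    σ.apply (a :: v) = σ a ++ σ.apply v := List.flatMap_cons

theorem Substitution.apply_nil (σ : Substitution A) : σ.apply [] = [] := rfl

theorem Substitution.apply_singleton (σ : Substitution A) (a : A) : σ.apply [a] = σ a := by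
  simp [Substitution.apply]

theorem Substitution.apply_infix (σ : Substitution A) {u v : List A} (h : u <:+: v) :
    σ.apply u <:+: σ.apply v := by
  obtain ⟨p, q, rfl⟩ := h
  exact ⟨σ.apply p, σ.apply q, by simp [Substitution.apply_append]⟩

theorem compose_append (τ : ℕ → Substitution A) (n : ℕ) (u v : List A) :
    compose τ n (u ++ v) = compose τ n u ++ compose τ n v := by
  induction n generalizing u v with
  | zero => rfl
  | succ n ih => simp only [compose, Substitution.apply_append, ih]

theorem compose_infix (τ : ℕ → Substitution A) (n : ℕ) {u v : List A} (h : u <:+: v) :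
    compose τ n u <:+: compose τ n v := by
  obtain ⟨p, q, rfl⟩ := h
  exact ⟨compose τ n p, compose τ n q, by simp [compose_append]⟩

theorem compose_infix_of_mem (τ : ℕ → Substitution A) (n : ℕ) {b : A} {v : List A}
    (h : b ∈ v) : compose τ n [b] <:+: compose τ n v := by
  obtain ⟨p, q, rfl⟩ := List.append_of_mem h
  exact compose_infix τ n ⟨p, q, by simp⟩

theorem compose_add (τ : ℕ → Substitution A) (m k : ℕ) (u : List A) :
    compose τ (m + k) u = compose τ m (compose (fun i => τ (m + i)) k u) := by
  induction k generalizing u with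
  | zero => rfl
  | succ k ih => exact ih _

theorem compose_succ_eq_apply (τ : ℕ → Substitution A) (m : ℕ) (u : List A) :
    compose τ (m + 1) u = (τ 0).apply (compose (shift τ) m u) := by
  have h := compose_add τ 1 m u
  rw [add_comm] at h
  rw [h]
  change (τ 0).apply (compose (fun i => τ (1 + i)) m u) = _
  congr 2
  funext i
  simp [shift, add_comm]

theorem compose_ne_nil {τ : ℕ → Substitution A} (hτ : ∀ n a, τ n a ≠ []) (n : ℕ) {u : List A}
    (hu : u ≠ []) : compose τ n u ≠ [] := by
  induction n generalizing u with
  | zero => exact hu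
  | succ n ih =>
    refine ih ?_
    obtain ⟨a, v, rfl⟩ := List.exists_cons_of_ne_nil hu
    simp [Substitution.apply_cons, hτ n a]

/-- The language of a directive sequence: the factors of the words `τ 0 (⋯ (τ (m - 1) b))`. -/
def Lang (τ : ℕ → Substitution A) (u : List A) : Prop := ∃ m b, u <:+: compose τ m [b]

theorem Lang.of_infix {τ : ℕ → Substitution A} {u v : List A} (h : Lang τ v) (huv : u <:+: v) :
    Lang τ u := by
  obtain ⟨m, b, hm⟩ := h
  exact ⟨m, b, huv.trans hm⟩

theorem lang_singleton (τ : ℕ → Substitution A) (a : A) : Lang τ [a] :=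
  ⟨0, a, List.infix_rfl⟩

theorem Lang.apply {τ : ℕ → Substitution A} {v u : List A} (h : Lang (shift τ) v)
    (hu : u <:+: (τ 0).apply v) : Lang τ u := by
  obtain ⟨m, b, hm⟩ := h
  refine ⟨m + 1, b, hu.trans ?_⟩
  rw [compose_succ_eq_apply]
  exact Substitution.apply_infix _ hm

end General

/-! ### Selmer sequences -/

/-- Sequences over `{s₁, s₂}` that are not eventually a concatenation of the blocks
`s₁ s₁` and `s₂ s₂`. -/
structure Good (τ : ℕ → Substitution (Fin 3)) : Prop where
  mem : ∀ n, τ n = s₁ ∨ τ n = s₂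
  ne : ∀ n, ∃ k, τ (n + 2 * k) ≠ τ (n + 2 * k + 1)

theorem Good.drop {τ : ℕ → Substitution (Fin 3)} (h : Good τ) (m : ℕ) :
    Good (fun i => τ (m + i)) where
  mem n := h.mem _
  ne n := by
    obtain ⟨k, hk⟩ := h.ne (m + n)
    exact ⟨k, by simpa only [add_assoc] using hk⟩

theorem Good.shift {τ : ℕ → Substitution (Fin 3)} (h : Good τ) : Good (shift τ) := by
  rw [show Selmer.shift τ = fun i => τ (1 + i) from funext fun i => by
    rw [Selmer.shift, add_comm]]
  exact h.drop 1

theorem Good.apply_ne_nil {τ : ℕ → Substitution (Fin 3)} (h : Good τ) (n : ℕ) (a : Fin 3) :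
    τ n a ≠ [] := by
  rcases h.mem n with e | e <;> rw [e] <;> fin_cases a <;> simp [s₁, s₂]

theorem mem_compose_succ {τ : ℕ → Substitution (Fin 3)} {a b c : Fin 3} {m : ℕ}
    (h : a ∈ compose τ m [c]) (hc : c ∈ τ m b) : a ∈ compose τ (m + 1) [b] := by
  change a ∈ compose τ m ((τ m).apply [b])
  rw [Substitution.apply_singleton]
  exact (compose_infix_of_mem τ m hc).subset h

/-- Under `s₁ s₁` and `s₂ s₂` the image of `1` contains `1` and that of `2` contains `2`, so the two
memberships survive equal blocks. Under `s₁ s₂` and `s₂ s₁` the image of every letter contains `1`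
or `2`, so the first unequal block finishes. -/
theorem Good.mem_compose_of_pair {τ : ℕ → Substitution (Fin 3)} (h : Good τ) {a : Fin 3} (k : ℕ) :
    ∀ m, a ∈ compose τ m [1] → a ∈ compose τ m [2] → τ (m + 2 * k) ≠ τ (m + 2 * k + 1) →
      ∃ m, ∀ b, a ∈ compose τ m [b] := by
  have step : ∀ m, a ∈ compose τ m [1] → a ∈ compose τ m [2] → τ m ≠ τ (m + 1) →
      ∃ m, ∀ b, a ∈ compose τ m [b] := by
    intro m h1 h2 hne
    refine ⟨m + 2, fun b => ?_⟩
    rcases h.mem m with e | e <;> rcases h.mem (m + 1) with e' | e'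
    · exact absurd (e.trans e'.symm) hne
    · have k0 : a ∈ compose τ (m + 1) [0] := mem_compose_succ h1 (by simp [e, s₁])
      have k2 : a ∈ compose τ (m + 1) [2] := mem_compose_succ h2 (by simp [e, s₁])
      fin_cases b
      · exact mem_compose_succ k2 (by simp [e', s₂])
      · exact mem_compose_succ k0 (by simp [e', s₂])
      · exact mem_compose_succ k0 (by simp [e', s₂])
    · have k0 : a ∈ compose τ (m + 1) [0] := mem_compose_succ h2 (by simp [e, s₂])
      have k1 : a ∈ compose τ (m + 1) [1] := mem_compose_succ h1 (by simp [e, s₂])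
      fin_cases b
      · exact mem_compose_succ k1 (by simp [e', s₁])
      · exact mem_compose_succ k0 (by simp [e', s₁])
      · exact mem_compose_succ k0 (by simp [e', s₁])
    · exact absurd (e.trans e'.symm) hne
  induction k with
  | zero => exact step
  | succ k ih =>
    intro m h1 h2 hne
    by_cases heq : τ m = τ (m + 1)
    · refine ih (m + 2) ?_ ?_ (by convert hne using 2 <;> ring_nf)
      · rcases h.mem m with e | e <;> rw [e] at heq
        · exact mem_compose_succ (c := 0) (mem_compose_succ h1 (by simp [e, s₁]))
            (by simp [← heq, s₁])
        · exact mem_compose_succ (c := 1) (mem_compose_succ h1 (by simp [e, s₂]))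
            (by simp [← heq, s₂])
      · rcases h.mem m with e | e <;> rw [e] at heq
        · exact mem_compose_succ (c := 2) (mem_compose_succ h2 (by simp [e, s₁]))
            (by simp [← heq, s₁])
        · exact mem_compose_succ (c := 0) (mem_compose_succ h2 (by simp [e, s₂]))
            (by simp [← heq, s₂])
    · exact step m h1 h2 heq

/-- It suffices to reach `a` from the letter `0`: both substitutions put `0` into the images of `1`
and `2`, so the pair lemma takes over one level deeper. -/
theorem Good.exists_mem_compose {τ : ℕ → Substitution (Fin 3)} (h : Good τ) (a : Fin 3) :
    ∃ m, ∀ b, a ∈ compose τ m [b] := by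
  have main : ∀ m, a ∈ compose τ m [0] → ∃ m, ∀ b, a ∈ compose τ m [b] := by
    intro m h0
    obtain ⟨k, hk⟩ := h.ne (m + 1)
    refine h.mem_compose_of_pair k (m + 1) ?_ ?_ hk <;>
    · refine mem_compose_succ h0 ?_
      rcases h.mem m with e | e <;> simp [e, s₁, s₂]
  have hlast : ∀ n, a ∈ compose τ n [a] ∨ ∃ m, a ∈ compose τ m [0] := by
    intro n
    induction n with
    | zero => left; simp [compose]
    | succ n ih =>
      rcases ih with ih | ih
      · fin_cases a
        · exact Or.inr ⟨n, ih⟩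
        · rcases h.mem n with e | e
          · exact Or.inr ⟨n + 1, mem_compose_succ ih (by simp [e, s₁])⟩
          · exact Or.inl (mem_compose_succ ih (by simp [e, s₂]))
        · rcases h.mem n with e | e
          · exact Or.inl (mem_compose_succ ih (by simp [e, s₁]))
          · exact Or.inr ⟨n + 1, mem_compose_succ ih (by simp [e, s₂])⟩
      · exact Or.inr ih
  obtain ⟨k, hk⟩ := h.ne 0
  rcases hlast (0 + 2 * k) with h1 | ⟨m, hm⟩
  swap
  · exact main m hm
  rcases hlast (0 + 2 * k + 1) with h2 | ⟨m, hm⟩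
  swap
  · exact main m hm
  -- The letter `1` is in the image of `0` only under `s₁`, and `2` only under `s₂`. An unequal
  -- block offers both substitutions, so the suitable one can be chosen.
  have hh : ∃ n, (τ n = s₁ ∨ a ≠ 1) ∧ (τ n = s₂ ∨ a ≠ 2) ∧ a ∈ compose τ n [a] := by
    rcases h.mem (0 + 2 * k) with e | e <;> rcases h.mem (0 + 2 * k + 1) with e' | e'
    · exact absurd (e.trans e'.symm) hk
    · by_cases ha : a = 2
      · exact ⟨_, Or.inr (by simp [ha]), Or.inl e', h2⟩
      · exact ⟨_, Or.inl e, Or.inr ha, h1⟩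
    · by_cases ha : a = 2
      · exact ⟨_, Or.inr (by simp [ha]), Or.inl e, h1⟩
      · exact ⟨_, Or.inl e', Or.inr ha, h2⟩
    · exact absurd (e.trans e'.symm) hk
  obtain ⟨n, e1, e2, hn⟩ := hh
  fin_cases a
  · exact main n hn
  · exact main (n + 1) (mem_compose_succ hn (by simp at e1; simp [e1, s₁]))
  · exact main (n + 1) (mem_compose_succ hn (by simp at e2; simp [e2, s₂]))

theorem Good.exists_forall_mem_compose {τ : ℕ → Substitution (Fin 3)} (h : Good τ) :
    ∃ M, ∀ m ≥ M, ∀ a b, a ∈ compose τ m [b] := by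
  choose m hm using h.exists_mem_compose
  refine ⟨m 0 + m 1 + m 2, fun n hn a b => ?_⟩
  have hle : m a ≤ n := by fin_cases a <;> simp <;> omega
  obtain ⟨k, rfl⟩ := Nat.exists_eq_add_of_le hle
  rw [compose_add]
  obtain ⟨c, v, hv⟩ := List.exists_cons_of_ne_nil
    (compose_ne_nil (h.drop (m a)).apply_ne_nil k (List.cons_ne_nil b []))
  rw [hv]
  exact (compose_infix_of_mem τ _ (List.mem_cons_self)).subset (hm a c)

theorem Lang.eventually {τ : ℕ → Substitution (Fin 3)} (h : Good τ) {u : List (Fin 3)}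
    (hu : Lang τ u) : ∃ M, ∀ m ≥ M, ∀ b, u <:+: compose τ m [b] := by
  obtain ⟨m, b, hm⟩ := hu
  obtain ⟨M, hM⟩ := (h.drop m).exists_forall_mem_compose
  refine ⟨m + M, fun n hn c => hm.trans ?_⟩
  obtain ⟨k, rfl⟩ := Nat.exists_eq_add_of_le (show m ≤ n by omega)
  rw [compose_add]
  exact compose_infix_of_mem _ _ (hM k (by omega) b c)

theorem Lang.exists_apply {τ : ℕ → Substitution (Fin 3)} (h : Good τ) {u : List (Fin 3)}
    (hu : Lang τ u) : ∃ v, Lang (Selmer.shift τ) v ∧ u <:+: (τ 0).apply v := by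
  obtain ⟨M, hM⟩ := hu.eventually h
  refine ⟨compose (Selmer.shift τ) M [0], ⟨M, 0, List.infix_rfl⟩, ?_⟩
  rw [← compose_succ_eq_apply]
  exact hM _ (by omega) _

theorem Good.three_le_length {τ : ℕ → Substitution (Fin 3)} (h : Good τ) :
    ∃ M, ∀ m ≥ M, ∀ b, 3 ≤ (compose τ m [b]).length := by
  obtain ⟨M, hM⟩ := h.exists_forall_mem_compose
  refine ⟨M, fun m hm b => ?_⟩
  have hs : (Finset.univ : Finset (Fin 3)) ⊆ (compose τ m [b]).toFinset := fun a _ => by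
    simpa using hM m hm a b
  simpa using (Finset.card_le_card hs).trans (List.toFinset_card_le _)

/-- A deep enough image has three consecutive letters `p q r`; `u` occurs inside the image of `q`,
and the nonempty images of `p` and `r` supply neighbours on both sides. -/
theorem Lang.exists_extension {τ : ℕ → Substitution (Fin 3)} (h : Good τ) {u : List (Fin 3)}
    (hu : Lang τ u) : ∃ a c, Lang τ (a :: (u ++ [c])) := by
  obtain ⟨m, hm⟩ := hu.eventually h
  obtain ⟨M, hM⟩ := (h.drop m).three_le_length
  have hlen := hM M le_rfl 0
  obtain ⟨p, q, r, t, hw⟩ : ∃ p q r t, compose (fun i => τ (m + i)) M [0] = p :: q :: r :: t := by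
    match compose (fun i => τ (m + i)) M [0], hlen with
    | p :: q :: r :: t, _ => exact ⟨p, q, r, t, rfl⟩
  have hl : Lang τ (compose τ m (p :: q :: r :: t)) := by
    rw [← hw, ← compose_add]
    exact ⟨m + M, 0, List.infix_rfl⟩
  obtain ⟨x, y, hxy⟩ := hm m le_rfl q
  have hp : compose τ m [p] ++ x ≠ [] := by
    simp [compose_ne_nil h.apply_ne_nil m (List.cons_ne_nil p [])]
  have hr : y ++ compose τ m [r] ≠ [] := by
    simp [compose_ne_nil h.apply_ne_nil m (List.cons_ne_nil r [])]
  obtain ⟨x', a, hx⟩ := List.eq_nil_or_concat _ |>.resolve_left hp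
  obtain ⟨c, y', hy⟩ := List.exists_cons_of_ne_nil hr
  refine ⟨a, c, hl.of_infix ⟨x', y' ++ compose τ m t, ?_⟩⟩
  rw [show p :: q :: r :: t = [p] ++ [q] ++ [r] ++ t by simp]
  simp only [compose_append, ← hxy]
  simp only [List.concat_eq_append] at hx
  calc _ = (x' ++ [a]) ++ u ++ (c :: y') ++ compose τ m t := by simp
    _ = _ := by rw [← hx, ← hy]; simp

theorem Lang.exists_left {τ : ℕ → Substitution (Fin 3)} (h : Good τ) {u : List (Fin 3)}
    (hu : Lang τ u) : ∃ a, Lang τ (a :: u) := by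
  obtain ⟨a, c, hac⟩ := hu.exists_extension h
  exact ⟨a, hac.of_infix ⟨[], [c], by simp⟩⟩

theorem Lang.exists_right {τ : ℕ → Substitution (Fin 3)} (h : Good τ) {u : List (Fin 3)}
    (hu : Lang τ u) : ∃ c, Lang τ (u ++ [c]) := by
  obtain ⟨a, c, hac⟩ := hu.exists_extension h
  exact ⟨c, hac.of_infix ⟨[a], [], by simp⟩⟩

/-! ### Desubstitution -/

/-- The only image of length two is `s₁ 2 = [2, 0]`, and `2` arises nowhere else, so a cut falls
inside an image exactly when it comes right after a `2`. -/
theorem exists_cut_s₁ {w x y : List (Fin 3)} (h : s₁.apply w = x ++ y) (hx : ¬ [2] <:+ x) :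
    ∃ w₁ w₂, w = w₁ ++ w₂ ∧ s₁.apply w₁ = x ∧ s₁.apply w₂ = y := by
  induction w generalizing x with
  | nil =>
    obtain ⟨rfl, rfl⟩ := List.append_eq_nil_iff.1 h.symm
    exact ⟨[], [], rfl, rfl, rfl⟩
  | cons c w ih =>
    rw [Substitution.apply_cons] at h
    rcases x with _ | ⟨p, x⟩
    · exact ⟨[], c :: w, rfl, rfl, by rw [Substitution.apply_cons, h]; rfl⟩
    have hx' : ¬ [2] <:+ x := fun h' => hx (h'.trans (List.suffix_cons p x))
    have one : s₁ c = [p] → s₁.apply w = x ++ y →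
        ∃ w₁ w₂, c :: w = w₁ ++ w₂ ∧ s₁.apply w₁ = p :: x ∧ s₁.apply w₂ = y := by
      intro hc hw
      obtain ⟨w₁, w₂, rfl, h1, h2⟩ := ih hw hx'
      exact ⟨c :: w₁, w₂, rfl, by rw [Substitution.apply_cons, hc, h1]; rfl, h2⟩
    fin_cases c
    · simp [s₁] at h
      exact one (by simp [s₁, h.1]) h.2
    · simp [s₁] at h
      exact one (by simp [s₁, h.1]) h.2
    · simp [s₁] at h
      obtain ⟨rfl, h⟩ := h
      rcases x with _ | ⟨q, x⟩
      · exact absurd (List.suffix_refl _) hx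
      simp at h
      obtain ⟨rfl, h⟩ := h
      obtain ⟨w₁, w₂, rfl, h1, h2⟩ := ih h (fun h' => hx' (h'.trans (List.suffix_cons _ x)))
      exact ⟨2 :: w₁, w₂, rfl, by rw [Substitution.apply_cons, h1]; rfl, h2⟩

/-- Here the only interior cut is the one in `s₂ 1 = [0, 1]`, right before a `1`. Reversing words
and exchanging `1` and `2` turns `s₁` into `s₂`. -/
theorem exists_cut_s₂ {w x y : List (Fin 3)} (h : s₂.apply w = x ++ y) (hy : ¬ [1] <+: y) :
    ∃ w₁ w₂, w = w₁ ++ w₂ ∧ s₂.apply w₁ = x ∧ s₂.apply w₂ = y := by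
  induction w generalizing x with
  | nil =>
    obtain ⟨rfl, rfl⟩ := List.append_eq_nil_iff.1 h.symm
    exact ⟨[], [], rfl, rfl, rfl⟩
  | cons c w ih =>
    rw [Substitution.apply_cons] at h
    rcases x with _ | ⟨p, x⟩
    · exact ⟨[], c :: w, rfl, rfl, by rw [Substitution.apply_cons, h]; rfl⟩
    have one : s₂ c = [p] → s₂.apply w = x ++ y →
        ∃ w₁ w₂, c :: w = w₁ ++ w₂ ∧ s₂.apply w₁ = p :: x ∧ s₂.apply w₂ = y := by
      intro hc hw
      obtain ⟨w₁, w₂, rfl, h1, h2⟩ := ih hw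
      exact ⟨c :: w₁, w₂, rfl, by rw [Substitution.apply_cons, hc, h1]; rfl, h2⟩
    fin_cases c
    · simp [s₂] at h
      exact one (by simp [s₂, h.1]) h.2
    · simp [s₂] at h
      obtain ⟨rfl, h⟩ := h
      rcases x with _ | ⟨q, x⟩
      · exact absurd ⟨_, h⟩ hy
      simp at h
      obtain ⟨rfl, h⟩ := h
      obtain ⟨w₁, w₂, rfl, h1, h2⟩ := ih h
      exact ⟨1 :: w₁, w₂, rfl, by rw [Substitution.apply_cons, h1]; rfl, h2⟩
    · simp [s₂] at h
      exact one (by simp [s₂, h.1]) h.2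

theorem exists_last_of_apply_eq {σ : Substitution (Fin 3)} {α : Fin 3 → Fin 3}
    (hα : ∀ a, ∃ l, σ a = l ++ [α a]) {w x : List (Fin 3)} {a : Fin 3}
    (h : σ.apply w = x ++ [a]) :
    ∃ w' a', w = w' ++ [a'] ∧ α a' = a ∧ σ.apply w' ++ σ a' = x ++ [a] := by
  rcases List.eq_nil_or_concat w with rfl | ⟨w', a', rfl⟩
  · simp [Substitution.apply_nil] at h
  rw [List.concat_eq_append] at h ⊢
  rw [Substitution.apply_append, Substitution.apply_singleton] at h
  obtain ⟨l, hl⟩ := hα a'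
  refine ⟨w', a', rfl, ?_, h⟩
  rw [hl, ← List.append_assoc] at h
  simpa using (List.append_inj' h rfl).2

theorem exists_head_of_apply_eq {σ : Substitution (Fin 3)} {β : Fin 3 → Fin 3}
    (hβ : ∀ a, ∃ l, σ a = β a :: l) {w y : List (Fin 3)} {c : Fin 3}
    (h : σ.apply w = c :: y) :
    ∃ c' w', w = c' :: w' ∧ β c' = c ∧ σ c' ++ σ.apply w' = c :: y := by
  rcases w with _ | ⟨c', w'⟩
  · simp [Substitution.apply_nil] at h
  rw [Substitution.apply_cons] at h
  obtain ⟨l, hl⟩ := hβ c'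
  refine ⟨c', w', rfl, ?_, h⟩
  rw [hl] at h
  simp at h
  exact h.1

/-- The last letters of the words `s₁ a`. -/
def last₁ : Fin 3 → Fin 3 := ![1, 0, 0]

/-- The first letters of the words `s₁ a`. -/
def head₁ : Fin 3 → Fin 3 := ![1, 0, 2]

/-- The last letters of the words `s₂ a`. -/
def last₂ : Fin 3 → Fin 3 := ![2, 1, 0]

/-- The first letters of the words `s₂ a`. -/
def head₂ : Fin 3 → Fin 3 := ![2, 0, 0]

theorem s₁_last (a : Fin 3) : ∃ l, s₁ a = l ++ [last₁ a] := by
  fin_cases a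
  exacts [⟨[], rfl⟩, ⟨[], rfl⟩, ⟨[2], rfl⟩]

theorem s₁_head (a : Fin 3) : ∃ l, s₁ a = head₁ a :: l := by
  fin_cases a
  exacts [⟨[], rfl⟩, ⟨[], rfl⟩, ⟨[0], rfl⟩]

theorem s₂_last (a : Fin 3) : ∃ l, s₂ a = l ++ [last₂ a] := by
  fin_cases a
  exacts [⟨[], rfl⟩, ⟨[0], rfl⟩, ⟨[], rfl⟩]

theorem s₂_head (a : Fin 3) : ∃ l, s₂ a = head₂ a :: l := by
  fin_cases a
  exacts [⟨[], rfl⟩, ⟨[1], rfl⟩, ⟨[], rfl⟩]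

theorem head₁_injective : Function.Injective head₁ := by decide

theorem last₂_injective : Function.Injective last₂ := by decide

theorem apply_s₁_injective : Function.Injective s₁.apply := by
  intro u
  induction u with
  | nil =>
    intro v h
    rcases v with _ | ⟨c, v⟩
    · rfl
    · obtain ⟨l, hl⟩ := s₁_head c
      simp [Substitution.apply_cons, Substitution.apply_nil, hl] at h
  | cons a u ih =>
    intro v h
    obtain ⟨l, hl⟩ := s₁_head a
    have h' := h
    rw [Substitution.apply_cons, hl] at h'
    obtain ⟨c, v, rfl, hc, -⟩ := exists_head_of_apply_eq s₁_head h'.symm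
    obtain rfl := head₁_injective hc
    simp only [Substitution.apply_cons, List.append_cancel_left_eq] at h
    rw [ih h]

theorem apply_s₂_injective : Function.Injective s₂.apply := by
  intro u
  induction u using List.reverseRecOn with
  | nil =>
    intro v h
    rcases v with _ | ⟨c, v⟩
    · rfl
    · obtain ⟨l, hl⟩ := s₂_head c
      simp [Substitution.apply_cons, Substitution.apply_nil, hl] at h
  | append_singleton u a ih =>
    intro v h
    obtain ⟨l, hl⟩ := s₂_last a
    have h' := h
    rw [Substitution.apply_append, Substitution.apply_singleton, hl, ← List.append_assoc] at h'
    obtain ⟨v, c, rfl, hc, -⟩ := exists_last_of_apply_eq s₂_last h'.symm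
    obtain rfl := last₂_injective hc
    simp only [Substitution.apply_append, List.append_cancel_right_eq] at h
    rw [ih h]

theorem Lang.apply_of_ends {τ : ℕ → Substitution (Fin 3)} {α β : Fin 3 → Fin 3}
    (hα : ∀ a, ∃ l, τ 0 a = l ++ [α a]) (hβ : ∀ a, ∃ l, τ 0 a = β a :: l)
    {a c : Fin 3} {v : List (Fin 3)} (h : Lang (shift τ) (a :: (v ++ [c]))) :
    Lang τ (α a :: ((τ 0).apply v ++ [β c])) := by
  obtain ⟨l, hl⟩ := hα a
  obtain ⟨r, hr⟩ := hβ c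
  refine h.apply ⟨l, r, ?_⟩
  simp [Substitution.apply_cons, Substitution.apply_append, hl, hr, Substitution.apply_nil]

theorem Lang.desubst_s₁ {τ : ℕ → Substitution (Fin 3)} (h : Good τ) (h0 : τ 0 = s₁)
    {a c : Fin 3} {u : List (Fin 3)} (ha : a ≠ 2) (hu : ¬ [2] <:+ u)
    (hL : Lang τ (a :: (u ++ [c]))) :
    ∃ a' v c', Lang (shift τ) (a' :: (v ++ [c'])) ∧ s₁.apply v = u ∧ last₁ a' = a ∧
      head₁ c' = c := by
  obtain ⟨w, hw, x, y, hxy⟩ := hL.exists_apply h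
  rw [h0] at hxy
  have hxa : ¬ [2] <:+ x ++ [a] := by
    rintro ⟨t, ht⟩
    exact ha (by simpa using (List.append_inj' ht rfl).2.symm)
  have e1 : s₁.apply w = (x ++ [a]) ++ (u ++ c :: y) := by simp [← hxy]
  obtain ⟨w₁, w₂, rfl, h1, h2⟩ := exists_cut_s₁ e1 hxa
  obtain ⟨v, w₃, rfl, h3, h4⟩ := exists_cut_s₁ h2 hu
  obtain ⟨w₁, a', rfl, ha', -⟩ := exists_last_of_apply_eq s₁_last h1
  obtain ⟨c', w₃, rfl, hc', -⟩ := exists_head_of_apply_eq s₁_head h4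
  exact ⟨a', v, c', hw.of_infix ⟨w₁, w₃, by simp⟩, h3, ha', hc'⟩

/-- The leading `0` determines the left neighbour although `last₁` is not injective: it is either
the end of `s₁ 2`, preceded by `2`, or it is `s₁ 1`, and then the nonzero letter before it can only
be `1`. In both cases `a` is its own preimage. -/
theorem Lang.desubst_zero_s₁ {τ : ℕ → Substitution (Fin 3)} (h : Good τ) (h0 : τ 0 = s₁)
    {a c : Fin 3} {t : List (Fin 3)} (ha : a ≠ 0) (ht : ¬ [2] <:+ t)
    (hL : Lang τ (a :: (0 :: t ++ [c]))) :
    ∃ v c', Lang (shift τ) (a :: (v ++ [c'])) ∧ s₁.apply v = t ∧ head₁ c' = c := by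
  obtain ⟨w, hw, x, y, hxy⟩ := hL.exists_apply h
  rw [h0] at hxy
  have hxa : ¬ [2] <:+ x ++ [a] ++ [0] := by
    rintro ⟨t, ht⟩
    simpa using (List.append_inj' ht rfl).2
  have e1 : s₁.apply w = (x ++ [a] ++ [0]) ++ (t ++ c :: y) := by simp [← hxy]
  obtain ⟨w₁, w₂, rfl, h1, h2⟩ := exists_cut_s₁ e1 hxa
  obtain ⟨v, w₃, rfl, h3, h4⟩ := exists_cut_s₁ h2 ht
  obtain ⟨w₁, a', rfl, ha', h5⟩ := exists_last_of_apply_eq s₁_last h1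
  obtain ⟨c', w₃, rfl, hc', -⟩ := exists_head_of_apply_eq s₁_head h4
  obtain rfl : a' = a := by
    have h6 : a' = 1 ∨ a' = 2 := (by decide : ∀ z, last₁ z = 0 → z = 1 ∨ z = 2) _ ha'
    rcases h6 with rfl | rfl
    · have h7 : s₁.apply w₁ = x ++ [a] := (List.append_inj' h5 rfl).1
      obtain ⟨_, b, -, hb, -⟩ := exists_last_of_apply_eq s₁_last h7
      exact (by decide : ∀ y z, y ≠ 0 → last₁ z = y → 1 = y) _ _ ha hb
    · have h7 : s₁.apply w₁ ++ [2] ++ [0] = x ++ [a] ++ [0] := by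
        rw [← h5]; simp [s₁]
      have h8 := (List.append_inj' (List.append_inj' h7 rfl).1 rfl).2
      simpa using h8
  exact ⟨v, c', hw.of_infix ⟨w₁, w₃, by simp⟩, h3, hc'⟩

theorem Lang.desubst_s₂ {τ : ℕ → Substitution (Fin 3)} (h : Good τ) (h0 : τ 0 = s₂)
    {a c : Fin 3} {u : List (Fin 3)} (hc : c ≠ 1) (hu : ¬ [1] <+: u)
    (hL : Lang τ (a :: (u ++ [c]))) :
    ∃ a' v c', Lang (shift τ) (a' :: (v ++ [c'])) ∧ s₂.apply v = u ∧ last₂ a' = a ∧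
      head₂ c' = c := by
  obtain ⟨w, hw, x, y, hxy⟩ := hL.exists_apply h
  rw [h0] at hxy
  have hcy : ¬ [1] <+: c :: y := by
    rintro ⟨t, ht⟩
    simp at ht
    exact hc ht.1.symm
  have e1 : s₂.apply w = (x ++ [a] ++ u) ++ (c :: y) := by simp [← hxy]
  obtain ⟨w₂, w₃, rfl, h2, h4⟩ := exists_cut_s₂ e1 hcy
  obtain ⟨w₁, v, rfl, h1, h3⟩ := exists_cut_s₂ h2 hu
  obtain ⟨w₁, a', rfl, ha', -⟩ := exists_last_of_apply_eq s₂_last h1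
  obtain ⟨c', w₃, rfl, hc', -⟩ := exists_head_of_apply_eq s₂_head h4
  exact ⟨a', v, c', hw.of_infix ⟨w₁, w₃, by simp⟩, h3, ha', hc'⟩

/-- Mirror image: the final `0` either begins `s₂ 1` and is followed by `1`, or is `s₂ 2` and is
followed by a nonzero first letter, which must be `2`. -/
theorem Lang.desubst_zero_s₂ {τ : ℕ → Substitution (Fin 3)} (h : Good τ) (h0 : τ 0 = s₂)
    {a c : Fin 3} {t : List (Fin 3)} (hc : c ≠ 0) (ht : ¬ [1] <+: t)
    (hL : Lang τ (a :: (t ++ [0] ++ [c]))) :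
    ∃ a' v, Lang (shift τ) (a' :: (v ++ [c])) ∧ s₂.apply v = t ∧ last₂ a' = a := by
  obtain ⟨w, hw, x, y, hxy⟩ := hL.exists_apply h
  rw [h0] at hxy
  have hcy : ¬ [1] <+: 0 :: c :: y := by simp
  have e1 : s₂.apply w = (x ++ [a] ++ t) ++ (0 :: c :: y) := by simp [← hxy]
  obtain ⟨w₂, w₃, rfl, h2, h4⟩ := exists_cut_s₂ e1 hcy
  obtain ⟨w₁, v, rfl, h1, h3⟩ := exists_cut_s₂ h2 ht
  obtain ⟨w₁, a', rfl, ha', -⟩ := exists_last_of_apply_eq s₂_last h1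
  obtain ⟨c', w₃, rfl, hc', h5⟩ := exists_head_of_apply_eq s₂_head h4
  obtain rfl : c' = c := by
    have h6 : c' = 1 ∨ c' = 2 := (by decide : ∀ z, head₂ z = 0 → z = 1 ∨ z = 2) _ hc'
    rcases h6 with rfl | rfl
    · simp [s₂] at h5
      exact h5.1
    · simp [s₂] at h5
      obtain ⟨b, _, -, hb, -⟩ := exists_head_of_apply_eq s₂_head h5
      exact (by decide : ∀ y z, y ≠ 0 → head₂ z = y → 2 = y) _ _ hc hb
  exact ⟨a', v, hw.of_infix ⟨w₁, w₃, by simp⟩, h3, ha'⟩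

theorem eq_zero_of_apply_s₁ {w x y : List (Fin 3)} {b : Fin 3}
    (h : s₁.apply w = x ++ 2 :: b :: y) : b = 0 := by
  induction w generalizing x with
  | nil => simp [Substitution.apply_nil] at h
  | cons c w ih =>
    rw [Substitution.apply_cons] at h
    rcases x with _ | ⟨p, x⟩
    · fin_cases c <;> simp [s₁] at h
      exact h.1.symm
    fin_cases c
    · simp [s₁] at h
      exact ih h.2
    · simp [s₁] at h
      exact ih h.2
    · rcases x with _ | ⟨q, x⟩
      · simp [s₁] at h
      · simp [s₁] at h
        exact ih h.2.2

theorem eq_zero_of_apply_s₂ {w x y : List (Fin 3)} {a : Fin 3}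
    (h : s₂.apply w = x ++ a :: 1 :: y) : a = 0 := by
  induction w generalizing x with
  | nil => simp [Substitution.apply_nil] at h
  | cons c w ih =>
    rw [Substitution.apply_cons] at h
    have hne : ∀ y, s₂.apply w ≠ 1 :: y := by
      intro y hy
      obtain ⟨z, -, -, hz, -⟩ := exists_head_of_apply_eq s₂_head hy
      exact (by decide : ∀ z, head₂ z ≠ 1) z hz
    rcases x with _ | ⟨p, x⟩
    · fin_cases c <;> simp [s₂] at h
      · exact absurd h.2 (hne _)
      · exact h.1.symm
      · exact h.1.symm
    fin_cases c
    · simp [s₂] at h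
      exact ih h.2
    · rcases x with _ | ⟨q, x⟩
      · simp [s₂] at h
        exact absurd h.2.2 (hne _)
      · simp [s₂] at h
        exact ih h.2.2
    · simp [s₂] at h
      exact ih h.2

/-! ### Factors of length two -/

/-- The pairs of letters that follow one another in a Selmer sequence. -/
def Adj (a b : Fin 3) : Prop :=
  (a, b) ∈ ([(0, 1), (0, 2), (1, 0), (1, 2), (2, 0)] : List (Fin 3 × Fin 3))

instance (a b : Fin 3) : Decidable (Adj a b) :=
  inferInstanceAs (Decidable ((a, b) ∈ _))

theorem Lang.pair_s₁ {τ : ℕ → Substitution (Fin 3)} (h : Good τ) (h0 : τ 0 = s₁)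
    {a b : Fin 3} (hL : Lang τ [a, b]) :
    (a = 2 ∧ b = 0) ∨ ∃ a' b', Lang (shift τ) [a', b'] ∧ last₁ a' = a ∧ head₁ b' = b := by
  by_cases ha : a = 2
  · subst ha
    obtain ⟨w, -, x, y, hxy⟩ := hL.exists_apply h
    rw [h0] at hxy
    exact Or.inl ⟨rfl, eq_zero_of_apply_s₁ (w := w) (x := x) (y := y) (by simp [← hxy])⟩
  · obtain ⟨a', v, b', hv, hv0, h1, h2⟩ := Lang.desubst_s₁ h h0 (u := []) ha (by simp) hL
    obtain rfl : v = [] := apply_s₁_injective hv0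
    exact Or.inr ⟨a', b', hv, h1, h2⟩

theorem Lang.pair_s₂ {τ : ℕ → Substitution (Fin 3)} (h : Good τ) (h0 : τ 0 = s₂)
    {a b : Fin 3} (hL : Lang τ [a, b]) :
    (a = 0 ∧ b = 1) ∨ ∃ a' b', Lang (shift τ) [a', b'] ∧ last₂ a' = a ∧ head₂ b' = b := by
  by_cases hb : b = 1
  · subst hb
    obtain ⟨w, -, x, y, hxy⟩ := hL.exists_apply h
    rw [h0] at hxy
    exact Or.inl ⟨eq_zero_of_apply_s₂ (w := w) (x := x) (y := y) (by simp [← hxy]), rfl⟩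
  · obtain ⟨a', v, b', hv, hv0, h1, h2⟩ := Lang.desubst_s₂ h h0 (u := []) hb (by simp) hL
    obtain rfl : v = [] := apply_s₂_injective hv0
    exact Or.inr ⟨a', b', hv, h1, h2⟩

theorem Lang.pair_map_s₁ {τ : ℕ → Substitution (Fin 3)} (h0 : τ 0 = s₁)
    {a b : Fin 3} (hL : Lang (shift τ) [a, b]) : Lang τ [last₁ a, head₁ b] :=
  Lang.apply_of_ends (τ := τ) (v := []) (by rw [h0]; exact s₁_last) (by rw [h0]; exact s₁_head) hL

theorem Lang.pair_map_s₂ {τ : ℕ → Substitution (Fin 3)} (h0 : τ 0 = s₂)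
    {a b : Fin 3} (hL : Lang (shift τ) [a, b]) : Lang τ [last₂ a, head₂ b] :=
  Lang.apply_of_ends (τ := τ) (v := []) (by rw [h0]; exact s₂_last) (by rw [h0]; exact s₂_head) hL

/-- A property that can hold only if the first two substitutions agree and that is then inherited
by the second shift never holds. -/
theorem Good.not_of_step (P : (ℕ → Substitution (Fin 3)) → Prop)
    (hP : ∀ τ, Good τ → P τ → τ 0 = τ 1 ∧ P (Selmer.shift (Selmer.shift τ)))
    {τ : ℕ → Substitution (Fin 3)} (h : Good τ) : ¬ P τ := by
  intro h1
  obtain ⟨k, hk⟩ := h.ne 0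
  induction k generalizing τ with
  | zero => exact hk (hP τ h h1).1
  | succ k ih =>
    refine ih h.shift.shift (hP τ h h1).2 ?_
    simp only [Selmer.shift]
    convert hk using 2 <;> ring_nf

theorem Lang.not_two_one {τ : ℕ → Substitution (Fin 3)} (h : Good τ) : ¬ Lang τ [2, 1] := by
  intro hL
  rcases h.mem 0 with h0 | h0
  · rcases hL.pair_s₁ h h0 with ⟨-, h⟩ | ⟨a, b, -, h, -⟩
    · simp at h
    · exact (by decide : ∀ a, last₁ a ≠ 2) a h
  · rcases hL.pair_s₂ h h0 with ⟨h, -⟩ | ⟨a, b, -, -, h⟩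
    · simp at h
    · exact (by decide : ∀ a, head₂ a ≠ 1) b h

theorem Lang.of_one_one {τ : ℕ → Substitution (Fin 3)} (h : Good τ) (hL : Lang τ [1, 1]) :
    τ 0 = s₁ ∧ Lang (shift τ) [0, 0] := by
  rcases h.mem 0 with h0 | h0
  · rcases hL.pair_s₁ h h0 with ⟨-, h⟩ | ⟨a, b, hab, h1, h2⟩
    · simp at h
    · obtain ⟨rfl, rfl⟩ : a = 0 ∧ b = 0 :=
        (by decide : ∀ a b, last₁ a = 1 → head₁ b = 1 → a = 0 ∧ b = 0) a b h1 h2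
      exact ⟨h0, hab⟩
  · rcases hL.pair_s₂ h h0 with ⟨h, -⟩ | ⟨a, b, -, -, h⟩
    · simp at h
    · exact absurd h ((by decide : ∀ a, head₂ a ≠ 1) b)

theorem Lang.of_two_two {τ : ℕ → Substitution (Fin 3)} (h : Good τ) (hL : Lang τ [2, 2]) :
    τ 0 = s₂ ∧ Lang (shift τ) [0, 0] := by
  rcases h.mem 0 with h0 | h0
  · rcases hL.pair_s₁ h h0 with ⟨-, h⟩ | ⟨a, b, -, h, -⟩
    · simp at h
    · exact absurd h ((by decide : ∀ a, last₁ a ≠ 2) a)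
  · rcases hL.pair_s₂ h h0 with ⟨-, h⟩ | ⟨a, b, hab, h1, h2⟩
    · simp at h
    · obtain ⟨rfl, rfl⟩ : a = 0 ∧ b = 0 :=
        (by decide : ∀ a b, last₂ a = 2 → head₂ b = 2 → a = 0 ∧ b = 0) a b h1 h2
      exact ⟨h0, hab⟩

/-- Since `[2, 1]` is impossible, `[0, 0]` comes from `[1, 1]` under `s₁` or from `[2, 2]` under
`s₂`, and these come from `[0, 0]` again only under the same substitution. The ancestry would force
equal blocks forever. -/
theorem Lang.not_zero_zero {τ : ℕ → Substitution (Fin 3)} (h : Good τ) : ¬ Lang τ [0, 0] := by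
  refine Good.not_of_step (fun τ => Lang τ [0, 0]) (fun τ h hL => ?_) h
  rcases h.mem 0 with h0 | h0
  · rcases hL.pair_s₁ h h0 with ⟨h, -⟩ | ⟨a, b, hab, h1, h2⟩
    · simp at h
    obtain ⟨ha, rfl⟩ : (a = 1 ∨ a = 2) ∧ b = 1 :=
      (by decide : ∀ a b, last₁ a = 0 → head₁ b = 0 → (a = 1 ∨ a = 2) ∧ b = 1) a b h1 h2
    rcases ha with rfl | rfl
    · obtain ⟨h3, h4⟩ := hab.of_one_one h.shift
      exact ⟨h0.trans h3.symm, h4⟩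
    · exact absurd hab (Lang.not_two_one h.shift)
  · rcases hL.pair_s₂ h h0 with ⟨-, h⟩ | ⟨a, b, hab, h1, h2⟩
    · simp at h
    obtain ⟨rfl, hb⟩ : a = 2 ∧ (b = 1 ∨ b = 2) :=
      (by decide : ∀ a b, last₂ a = 0 → head₂ b = 0 → a = 2 ∧ (b = 1 ∨ b = 2)) a b h1 h2
    rcases hb with rfl | rfl
    · exact absurd hab (Lang.not_two_one h.shift)
    · obtain ⟨h3, h4⟩ := hab.of_two_two h.shift
      exact ⟨h0.trans h3.symm, h4⟩

theorem Lang.adj {τ : ℕ → Substitution (Fin 3)} (h : Good τ) {a b : Fin 3}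
    (hL : Lang τ [a, b]) : Adj a b := by
  by_contra hab
  have : (a, b) = (0, 0) ∨ (a, b) = (1, 1) ∨ (a, b) = (2, 2) ∨ (a, b) = (2, 1) := by
    revert hab
    clear hL
    revert a b
    decide
  simp only [Prod.mk.injEq] at this
  rcases this with ⟨rfl, rfl⟩ | ⟨rfl, rfl⟩ | ⟨rfl, rfl⟩ | ⟨rfl, rfl⟩
  · exact Lang.not_zero_zero h hL
  · exact Lang.not_zero_zero h.shift (hL.of_one_one h).2
  · exact Lang.not_zero_zero h.shift (hL.of_two_two h).2
  · exact Lang.not_two_one h hL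

theorem Good.lang_two_zero {τ : ℕ → Substitution (Fin 3)} (h : Good τ) : Lang τ [2, 0] := by
  obtain ⟨c, hc⟩ := (lang_singleton τ 2).exists_right h
  obtain rfl : c = 0 := (by decide : ∀ c, Adj 2 c → c = 0) c (Lang.adj h hc)
  exact hc

theorem Good.lang_zero_one {τ : ℕ → Substitution (Fin 3)} (h : Good τ) : Lang τ [0, 1] := by
  obtain ⟨c, hc⟩ := (lang_singleton τ 1).exists_left h
  obtain rfl : c = 0 := (by decide : ∀ c, Adj c 1 → c = 0) c (Lang.adj h hc)
  exact hc

/-- Equal blocks carry `[1, 2]` to itself, while `s₁ s₂` and `s₂ s₁` create it from `[2, 0]` and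
`[0, 1]`, which always occur. -/
theorem Good.lang_one_two {τ : ℕ → Substitution (Fin 3)} (h : Good τ) : Lang τ [1, 2] := by
  by_contra hL
  refine Good.not_of_step (fun τ => ¬ Lang τ [1, 2]) (fun τ h hL => ?_) h hL
  rcases h.mem 0 with h0 | h0 <;> rcases h.mem 1 with h1 | h1
  · refine ⟨h0.trans h1.symm, fun h2 => hL ?_⟩
    exact Lang.pair_map_s₁ h0 (Lang.pair_map_s₁ (τ := Selmer.shift τ) h1 h2)
  · exact absurd (Lang.pair_map_s₁ h0 (Lang.pair_map_s₂ (τ := Selmer.shift τ) h1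
      h.shift.shift.lang_two_zero)) hL
  · exact absurd (Lang.pair_map_s₂ h0 (Lang.pair_map_s₁ (τ := Selmer.shift τ) h1
      h.shift.shift.lang_zero_one)) hL
  · refine ⟨h0.trans h1.symm, fun h2 => hL ?_⟩
    exact Lang.pair_map_s₂ h0 (Lang.pair_map_s₂ (τ := Selmer.shift τ) h1 h2)

theorem Good.lang_zero_two {τ : ℕ → Substitution (Fin 3)} (h : Good τ) : Lang τ [0, 2] := by
  rcases h.mem 0 with h0 | h0
  · exact Lang.pair_map_s₁ h0 h.shift.lang_one_two
  · exact Lang.pair_map_s₂ h0 h.shift.lang_two_zero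

theorem Good.lang_one_zero {τ : ℕ → Substitution (Fin 3)} (h : Good τ) : Lang τ [1, 0] := by
  rcases h.mem 0 with h0 | h0
  · exact Lang.pair_map_s₁ h0 h.shift.lang_zero_one
  · exact Lang.pair_map_s₂ h0 h.shift.lang_one_two

theorem Good.lang_pair_iff {τ : ℕ → Substitution (Fin 3)} (h : Good τ) (a b : Fin 3) :
    Lang τ [a, b] ↔ Adj a b := by
  refine ⟨Lang.adj h, fun hab => ?_⟩
  simp only [Adj, List.mem_cons, Prod.mk.injEq, List.not_mem_nil, or_false] at hab
  rcases hab with ⟨rfl, rfl⟩ | ⟨rfl, rfl⟩ | ⟨rfl, rfl⟩ | ⟨rfl, rfl⟩ | ⟨rfl, rfl⟩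
  exacts [h.lang_zero_one, h.lang_zero_two, h.lang_one_zero, h.lang_one_two, h.lang_two_zero]

/-! ### Left special words -/

theorem Substitution.length_le_apply {σ : Substitution (Fin 3)} (hσ : ∀ a, σ a ≠ [])
    (u : List (Fin 3)) : u.length ≤ (σ.apply u).length := by
  induction u with
  | nil => simp
  | cons a u ih =>
    have := List.length_pos_iff.2 (hσ a)
    simp only [Substitution.apply_cons, List.length_append, List.length_cons]
    omega

theorem Lang.adj_left {τ : ℕ → Substitution (Fin 3)} (h : Good τ) {a p : Fin 3}
    {t : List (Fin 3)} (hL : Lang τ (a :: p :: t)) : Adj a p :=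
  Lang.adj h (hL.of_infix ⟨[], t, by simp⟩)

theorem Lang.adj_right {τ : ℕ → Substitution (Fin 3)} (h : Good τ) {a z c : Fin 3}
    {t : List (Fin 3)} (hL : Lang τ (a :: (t ++ [z] ++ [c]))) : Adj z c :=
  Lang.adj h (hL.of_infix ⟨a :: t, [], by simp⟩)

theorem Lang.exists_right_cons {τ : ℕ → Substitution (Fin 3)} (h : Good τ) {a : Fin 3}
    {u : List (Fin 3)} (hL : Lang τ (a :: u)) : ∃ c, Lang τ (a :: (u ++ [c])) :=
  hL.exists_right h

theorem Lang.of_append_right {τ : ℕ → Substitution (Fin 3)} {a c : Fin 3}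
    {u : List (Fin 3)} (hL : Lang τ (a :: (u ++ [c]))) : Lang τ (a :: u) :=
  hL.of_infix ⟨[], [c], by simp⟩

/-- A right extension that preserves left specialness exists and is unique. -/
def UniqueRight (τ : ℕ → Substitution (Fin 3)) (u : List (Fin 3)) : Prop :=
  ∀ a b, a ≠ b → Lang τ (a :: u) → Lang τ (b :: u) →
    ∃! c, Lang τ (a :: (u ++ [c])) ∧ Lang τ (b :: (u ++ [c]))

theorem uniqueRight_append_two {τ : ℕ → Substitution (Fin 3)} (h : Good τ) (t : List (Fin 3)) :
    UniqueRight τ (t ++ [2]) := by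
  intro a b _ ha hb
  obtain ⟨c, hc⟩ := ha.exists_right_cons h
  obtain ⟨d, hd⟩ := hb.exists_right_cons h
  obtain rfl : c = 0 := (by decide : ∀ c, Adj 2 c → c = 0) c (hc.adj_right h)
  obtain rfl : d = 0 := (by decide : ∀ c, Adj 2 c → c = 0) d (hd.adj_right h)
  exact ⟨0, ⟨hc, hd⟩, fun y hy =>
    (by decide : ∀ c, Adj 2 c → c = 0) y (hy.1.adj_right h)⟩

theorem uniqueRight_one_cons {τ : ℕ → Substitution (Fin 3)} (h : Good τ) (t : List (Fin 3)) :
    UniqueRight τ (1 :: t) := by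
  intro a b hab ha hb
  have ha' := ha.adj_left h
  have hb' := hb.adj_left h
  exact absurd ((by decide : ∀ a b, Adj a 1 → Adj b 1 → a = b) a b ha' hb') hab

/-- With `t = s₁ v`, the left extensions of `0 t` are those of `v`, letter for letter, and right
extensions correspond through the injective `head₁`. The word `v` may be empty; then `a` and `b` are
`1` and `2`, and adjacency settles the case. -/
theorem uniqueRight_zero_cons_s₁ {τ : ℕ → Substitution (Fin 3)} (h : Good τ) (h0 : τ 0 = s₁)
    {t : List (Fin 3)} (ht : ¬ [2] <:+ t)
    (ih : ∀ v : List (Fin 3), v ≠ [] → v.length < (0 :: t).length → UniqueRight (shift τ) v) :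
    UniqueRight τ (0 :: t) := by
  intro a b hab ha hb
  have key : ∀ a, Adj a 0 → ∀ v c, Lang (shift τ) (a :: (v ++ [c])) →
      Lang τ (a :: (0 :: s₁.apply v ++ [head₁ c])) := by
    intro a ha v c hL
    have e : a = 1 ∨ a = 2 := (by decide : ∀ a, Adj a 0 → a = 1 ∨ a = 2) a ha
    rcases e with rfl | rfl
    · obtain ⟨p, hp⟩ := hL.exists_left h.shift
      obtain rfl : p = 0 := (by decide : ∀ p, Adj p 1 → p = 0) p (hp.adj_left h.shift)
      have := Lang.apply_of_ends (τ := τ) (v := 1 :: v) (by rw [h0]; exact s₁_last)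
        (by rw [h0]; exact s₁_head) hp
      rw [h0, Substitution.apply_cons] at this
      exact this
    · obtain ⟨r, hr⟩ := s₁_head c
      refine hL.apply ⟨[], r, ?_⟩
      simp [h0, Substitution.apply_cons, Substitution.apply_append, hr, Substitution.apply_nil]
      simp [s₁]
  have a0 := ha.adj_left h
  have b0 := hb.adj_left h
  have hne : ∀ a, Adj a 0 → a ≠ 0 := by decide
  obtain ⟨c, hc⟩ := ha.exists_right_cons h
  obtain ⟨d, hd⟩ := hb.exists_right_cons h
  obtain ⟨v, c', hv, hvt, -⟩ := hc.desubst_zero_s₁ h h0 (hne a a0) ht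
  obtain ⟨v', d', hv', hvt', -⟩ := hd.desubst_zero_s₁ h h0 (hne b b0) ht
  obtain rfl : v' = v := apply_s₁_injective (hvt'.trans hvt.symm)
  have hu : ∃! c, Lang (shift τ) (a :: (v' ++ [c])) ∧ Lang (shift τ) (b :: (v' ++ [c])) := by
    by_cases hnil : v' = []
    · subst hnil
      simp only [List.nil_append, h.shift.lang_pair_iff]
      clear key hne hvt hvt' hv hv' hc hd ha hb
      change ∃ c, (Adj a c ∧ Adj b c) ∧ ∀ y, Adj a y ∧ Adj b y → y = c
      revert a b
      decide
    · refine ih v' hnil ?_ a b hab hv.of_append_right hv'.of_append_right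
      have := Substitution.length_le_apply (σ := s₁) (by decide) v'
      rw [hvt] at this
      simp only [List.length_cons]
      omega
  obtain ⟨e, ⟨he1, he2⟩, he⟩ := hu
  refine ⟨head₁ e, ⟨?_, ?_⟩, ?_⟩
  · rw [← hvt]; exact key a a0 v' e he1
  · rw [← hvt]; exact key b b0 v' e he2
  · rintro y ⟨hy1, hy2⟩
    obtain ⟨w, y', hw, hwt, hyy⟩ := hy1.desubst_zero_s₁ h h0 (hne a a0) ht
    obtain ⟨w', y'', hw', hwt', hyy'⟩ := hy2.desubst_zero_s₁ h h0 (hne b b0) ht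
    obtain rfl : w = v' := apply_s₁_injective (hwt.trans hvt.symm)
    obtain rfl : w' = w := apply_s₁_injective (hwt'.trans hvt.symm)
    obtain rfl : y' = y'' := head₁_injective (hyy.trans hyy'.symm)
    rw [← hyy, he y' ⟨hw, hw'⟩]

theorem uniqueRight_two_cons_s₁ {τ : ℕ → Substitution (Fin 3)} (h : Good τ) (h0 : τ 0 = s₁)
    {t : List (Fin 3)} (ht : ¬ [2] <:+ 2 :: t)
    (ih : ∀ v : List (Fin 3), v ≠ [] → v.length < (2 :: t).length → UniqueRight (shift τ) v) :
    UniqueRight τ (2 :: t) := by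
  intro a b hab ha hb
  have key : ∀ {a c v}, Lang (shift τ) (a :: (v ++ [c])) →
      Lang τ (last₁ a :: (s₁.apply v ++ [head₁ c])) := by
    intro a c v hL
    have := Lang.apply_of_ends (τ := τ) (v := v) (by rw [h0]; exact s₁_last)
      (by rw [h0]; exact s₁_head) hL
    rwa [h0] at this
  have hne : ∀ a, Adj a 2 → a ≠ 2 := by decide
  have a0 := ha.adj_left h
  have b0 := hb.adj_left h
  obtain ⟨c, hc⟩ := ha.exists_right_cons h
  obtain ⟨d, hd⟩ := hb.exists_right_cons h
  obtain ⟨a', v, c', hv, hvt, ha', -⟩ := hc.desubst_s₁ h h0 (hne a a0) ht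
  obtain ⟨b', v', d', hv', hvt', hb', -⟩ := hd.desubst_s₁ h h0 (hne b b0) ht
  obtain rfl : v' = v := apply_s₁_injective (hvt'.trans hvt.symm)
  obtain ⟨z, x, rfl, hz, hzx⟩ := exists_head_of_apply_eq s₁_head hvt
  obtain rfl : z = 2 := (by decide : ∀ z, head₁ z = 2 → z = 2) z hz
  have hlen : (2 :: x).length < (2 :: t).length := by
    have h1 := Substitution.length_le_apply (σ := s₁) (by decide) x
    rw [show s₁ 2 = [2, 0] from rfl] at hzx
    simp at hzx
    simp [← hzx]
    omega
  have hab' : a' ≠ b' := by rintro rfl; exact hab (ha'.symm.trans hb')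
  obtain ⟨e, ⟨he1, he2⟩, he⟩ := ih (2 :: x) (by simp) hlen a' b' hab' hv.of_append_right
    hv'.of_append_right
  -- `last₁` identifies `1` and `2`, but only `0` and `1` can precede `2`.
  have hinj : ∀ p q, Adj p 2 → Adj q 2 → last₁ p = last₁ q → p = q := by decide
  refine ⟨head₁ e, ⟨?_, ?_⟩, ?_⟩
  · rw [← hvt, ← ha']; exact key he1
  · rw [← hvt, ← hb']; exact key he2
  · rintro y ⟨hy1, hy2⟩
    obtain ⟨p, w, y', hw, hwt, hp, hyy⟩ := hy1.desubst_s₁ h h0 (hne a a0) ht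
    obtain ⟨q, w', y'', hw', hwt', hq, hyy'⟩ := hy2.desubst_s₁ h h0 (hne b b0) ht
    obtain rfl : w = 2 :: x := apply_s₁_injective (hwt.trans hvt.symm)
    obtain rfl : w' = 2 :: x := apply_s₁_injective (hwt'.trans hvt.symm)
    obtain rfl : y' = y'' := head₁_injective (hyy.trans hyy'.symm)
    obtain rfl : p = a' := hinj _ _ (hw.adj_left h.shift) (hv.adj_left h.shift) (hp.trans ha'.symm)
    obtain rfl : q = b' :=
      hinj _ _ (hw'.adj_left h.shift) (hv'.adj_left h.shift) (hq.trans hb'.symm)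
    rw [← hyy, he y' ⟨hw, hw'⟩]

theorem uniqueRight_append_zero_s₂ {τ : ℕ → Substitution (Fin 3)} (h : Good τ) (h0 : τ 0 = s₂)
    {t : List (Fin 3)} (ht : ¬ [1] <+: t)
    (ih : ∀ v : List (Fin 3), v ≠ [] → v.length < (t ++ [0]).length → UniqueRight (shift τ) v) :
    UniqueRight τ (t ++ [0]) := by
  intro a b hab ha hb
  have key : ∀ a v c, Adj 0 c → Lang (shift τ) (a :: (v ++ [c])) →
      Lang τ (last₂ a :: (s₂.apply v ++ [0] ++ [c])) := by
    intro a v c hc hL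
    have e : c = 1 ∨ c = 2 := (by decide : ∀ c, Adj 0 c → c = 1 ∨ c = 2) c hc
    rcases e with rfl | rfl
    · obtain ⟨l, hl⟩ := s₂_last a
      refine hL.apply ⟨l, [], ?_⟩
      simp [h0, Substitution.apply_cons, Substitution.apply_append, hl, Substitution.apply_nil]
      simp [s₂]
    · obtain ⟨p, hp⟩ := hL.exists_right h.shift
      have hp' : Lang (shift τ) (a :: (v ++ [2] ++ [p])) := hp
      obtain rfl : p = 0 := (by decide : ∀ p, Adj 2 p → p = 0) p (hp'.adj_right h.shift)
      have := Lang.apply_of_ends (τ := τ) (by rw [h0]; exact s₂_last)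
        (by rw [h0]; exact s₂_head) hp'
      rw [h0, Substitution.apply_append, Substitution.apply_singleton] at this
      exact this
  have hne : ∀ a, Adj 0 a → a ≠ 0 := by decide
  obtain ⟨c, hc⟩ := ha.exists_right_cons h
  obtain ⟨d, hd⟩ := hb.exists_right_cons h
  have c0 := hc.adj_right h
  have d0 := hd.adj_right h
  obtain ⟨a', v, hv, hvt, ha'⟩ := hc.desubst_zero_s₂ h h0 (hne c c0) ht
  obtain ⟨b', v', hv', hvt', hb'⟩ := hd.desubst_zero_s₂ h h0 (hne d d0) ht
  obtain rfl : v' = v := apply_s₂_injective (hvt'.trans hvt.symm)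
  have hab' : a' ≠ b' := by rintro rfl; exact hab (ha'.symm.trans hb')
  have hu : ∃ e, Adj 0 e ∧ (Lang (shift τ) (a' :: (v' ++ [e])) ∧
      Lang (shift τ) (b' :: (v' ++ [e]))) ∧ ∀ y, Adj 0 y → Lang (shift τ) (a' :: (v' ++ [y])) →
        Lang (shift τ) (b' :: (v' ++ [y])) → y = e := by
    by_cases hnil : v' = []
    · subst hnil
      obtain rfl : t = [] := hvt.symm
      have a1 : Adj a 0 := ha.adj_left h
      have b1 : Adj b 0 := hb.adj_left h
      simp only [List.nil_append, h.shift.lang_pair_iff]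
      rw [← ha'] at a1
      rw [← hb'] at b1
      clear key hne hvt hvt' hv hv' hc hd ha hb ha' hb' hab
      revert a' b'
      decide
    · obtain ⟨e, ⟨he1, he2⟩, he⟩ := ih v' hnil (by
        have := Substitution.length_le_apply (σ := s₂) (by decide) v'
        rw [hvt] at this
        simp only [List.length_append, List.length_singleton]
        omega) a' b' hab' hv.of_append_right hv'.of_append_right
      -- To lift `e` back through the final `0`, it must be able to follow `0`. If `c = d`,
      -- uniqueness gives `e = c`; otherwise the last letter of `v'` is followed by both `1` and
      -- `2`, hence is itself `0`.
      refine ⟨e, ?_, ⟨he1, he2⟩, fun y _ h1 h2 => he y ⟨h1, h2⟩⟩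
      rcases List.eq_nil_or_concat v' with h1 | ⟨x, z, rfl⟩
      · exact absurd h1 hnil
      rw [List.concat_eq_append] at hv hv' he1 he2 he
      have e1 := hv.adj_right h.shift
      have e2 := hv'.adj_right h.shift
      have e3 := he1.adj_right h.shift
      by_cases hcd : c = d
      · subst hcd
        rwa [← he c ⟨hv, hv'⟩]
      · exact (by decide : ∀ z c d e, Adj 0 c → Adj 0 d → c ≠ d → Adj z c → Adj z d → Adj z e →
          Adj 0 e) z c d e c0 d0 hcd e1 e2 e3
  obtain ⟨e, e0, ⟨he1, he2⟩, he⟩ := hu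
  refine ⟨e, ⟨?_, ?_⟩, ?_⟩
  · rw [← hvt, ← ha']; exact key _ _ _ e0 he1
  · rw [← hvt, ← hb']; exact key _ _ _ e0 he2
  · rintro y ⟨hy1, hy2⟩
    have y0 := hy1.adj_right h
    obtain ⟨p, w, hw, hwt, hp⟩ := hy1.desubst_zero_s₂ h h0 (hne y y0) ht
    obtain ⟨q, w', hw', hwt', hq⟩ := hy2.desubst_zero_s₂ h h0 (hne y y0) ht
    obtain rfl : w = v' := apply_s₂_injective (hwt.trans hvt.symm)
    obtain rfl : w' = w := apply_s₂_injective (hwt'.trans hvt.symm)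
    obtain rfl : p = a' := last₂_injective (hp.trans ha'.symm)
    obtain rfl : q = b' := last₂_injective (hq.trans hb'.symm)
    exact he y y0 hw hw'

theorem uniqueRight_append_one_s₂ {τ : ℕ → Substitution (Fin 3)} (h : Good τ) (h0 : τ 0 = s₂)
    {t : List (Fin 3)} (ht : ¬ [1] <+: t ++ [1])
    (ih : ∀ v : List (Fin 3), v ≠ [] → v.length < (t ++ [1]).length → UniqueRight (shift τ) v) :
    UniqueRight τ (t ++ [1]) := by
  intro a b hab ha hb
  have key : ∀ {a c v}, Lang (shift τ) (a :: (v ++ [c])) →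
      Lang τ (last₂ a :: (s₂.apply v ++ [head₂ c])) := by
    intro a c v hL
    have := Lang.apply_of_ends (τ := τ) (v := v) (by rw [h0]; exact s₂_last)
      (by rw [h0]; exact s₂_head) hL
    rwa [h0] at this
  have hne : ∀ a, Adj 1 a → a ≠ 1 := by decide
  obtain ⟨c, hc⟩ := ha.exists_right_cons h
  obtain ⟨d, hd⟩ := hb.exists_right_cons h
  obtain ⟨a', v, c', hv, hvt, ha', -⟩ := hc.desubst_s₂ h h0 (hne c (hc.adj_right h)) ht
  obtain ⟨b', v', d', hv', hvt', hb', -⟩ := hd.desubst_s₂ h h0 (hne d (hd.adj_right h)) ht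
  obtain rfl : v' = v := apply_s₂_injective (hvt'.trans hvt.symm)
  obtain ⟨x, z, rfl, hz, hzx⟩ := exists_last_of_apply_eq s₂_last hvt
  obtain rfl : z = 1 := (by decide : ∀ z, last₂ z = 1 → z = 1) z hz
  have hlen : (x ++ [1]).length < (t ++ [1]).length := by
    have h1 := Substitution.length_le_apply (σ := s₂) (by decide) x
    rw [← hzx, show s₂ 1 = [0, 1] from rfl]
    simp
    omega
  have hab' : a' ≠ b' := by rintro rfl; exact hab (ha'.symm.trans hb')
  obtain ⟨e, ⟨he1, he2⟩, he⟩ := ih (x ++ [1]) (by simp) hlen a' b' hab' hv.of_append_right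
    hv'.of_append_right
  -- `head₂` identifies `1` and `2`, but only `0` and `2` can follow `1`.
  have hinj : ∀ p q, Adj 1 p → Adj 1 q → head₂ p = head₂ q → p = q := by decide
  refine ⟨head₂ e, ⟨?_, ?_⟩, ?_⟩
  · rw [← hvt, ← ha']; exact key he1
  · rw [← hvt, ← hb']; exact key he2
  · rintro y ⟨hy1, hy2⟩
    have y0 := hne y (hy1.adj_right h)
    obtain ⟨p, w, y', hw, hwt, hp, hyy⟩ := hy1.desubst_s₂ h h0 y0 ht
    obtain ⟨q, w', y'', hw', hwt', hq, hyy'⟩ := hy2.desubst_s₂ h h0 y0 ht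
    obtain rfl : w = x ++ [1] := apply_s₂_injective (hwt.trans hvt.symm)
    obtain rfl : w' = x ++ [1] := apply_s₂_injective (hwt'.trans hvt.symm)
    obtain rfl : y' = y'' :=
      hinj _ _ (hw.adj_right h.shift) (hw'.adj_right h.shift) (hyy.trans hyy'.symm)
    obtain rfl : p = a' := last₂_injective (hp.trans ha'.symm)
    obtain rfl : q = b' := last₂_injective (hq.trans hb'.symm)
    rw [← hyy, he y' ⟨hw, hw'⟩]

theorem Good.uniqueRight {τ : ℕ → Substitution (Fin 3)} (h : Good τ) {u : List (Fin 3)}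
    (hu : u ≠ []) : UniqueRight τ u := by
  induction hn : u.length using Nat.strong_induction_on generalizing τ u with
  | _ n IH =>
  subst hn
  have ih : ∀ v : List (Fin 3), v ≠ [] → v.length < u.length → UniqueRight (Selmer.shift τ) v :=
    fun v hv hlt => IH _ hlt h.shift hv rfl
  clear IH
  by_cases h2 : [2] <:+ u
  · obtain ⟨t, rfl⟩ := h2
    exact uniqueRight_append_two h t
  by_cases h1 : [1] <+: u
  · obtain ⟨t, rfl⟩ := h1
    exact uniqueRight_one_cons h t
  rcases h.mem 0 with h0 | h0
  · obtain ⟨p, t, rfl⟩ := List.exists_cons_of_ne_nil hu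
    fin_cases p
    · exact uniqueRight_zero_cons_s₁ h h0 (fun h' => h2 (h'.trans (List.suffix_cons _ t))) ih
    · exact absurd ⟨t, rfl⟩ h1
    · exact uniqueRight_two_cons_s₁ h h0 h2 ih
  · obtain ⟨t, z, rfl⟩ := (List.eq_nil_or_concat u).resolve_left hu
    rw [List.concat_eq_append] at *
    fin_cases z
    · exact uniqueRight_append_zero_s₂ h h0
        (fun h' => h1 (h'.trans (List.prefix_append _ _))) ih
    · exact uniqueRight_append_one_s₂ h h0 h1 ih
    · exact absurd ⟨t, rfl⟩ h2

/-! ### Counting factors -/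

/-- The words of length `n` in the language. -/
def words (τ : ℕ → Substitution (Fin 3)) (n : ℕ) : Set (List (Fin 3)) :=
  {u | Lang τ u ∧ u.length = n}

/-- The left special words of length `n` in the language. -/
def leftSpecial (τ : ℕ → Substitution (Fin 3)) (n : ℕ) : Set (List (Fin 3)) :=
  {u | (∃ a b, a ≠ b ∧ Lang τ (a :: u) ∧ Lang τ (b :: u)) ∧ u.length = n}

theorem words_finite (τ : ℕ → Substitution (Fin 3)) (n : ℕ) : (words τ n).Finite :=
  (List.finite_length_eq (Fin 3) n).subset fun _ h => h.2

theorem ncard_leftSpecial_one {τ : ℕ → Substitution (Fin 3)} (h : Good τ) :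
    (leftSpecial τ 1).ncard = 2 := by
  have : leftSpecial τ 1 = {[0], [2]} := by
    ext u
    constructor
    · rintro ⟨⟨a, b, hab, ha, hb⟩, hu⟩
      obtain ⟨p, rfl⟩ := List.length_eq_one_iff.1 hu
      have := (by decide : ∀ a b p, a ≠ b → Adj a p → Adj b p → p = 0 ∨ p = 2) a b p hab
        (Lang.adj h ha) (Lang.adj h hb)
      simpa using this
    · rintro (rfl | rfl)
      · exact ⟨⟨1, 2, by decide, h.lang_one_zero, h.lang_two_zero⟩, rfl⟩
      · exact ⟨⟨0, 1, by decide, h.lang_zero_two, h.lang_one_two⟩, rfl⟩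
  rw [this]
  exact Set.ncard_pair (by decide)

/-- Deleting the last letter is a bijection between left special words: the existence half of
`Good.uniqueRight` gives surjectivity, the uniqueness half injectivity. -/
theorem ncard_leftSpecial_succ {τ : ℕ → Substitution (Fin 3)} (h : Good τ) (n : ℕ) :
    (leftSpecial τ (n + 2)).ncard = (leftSpecial τ (n + 1)).ncard := by
  have himg : List.dropLast '' leftSpecial τ (n + 2) = leftSpecial τ (n + 1) := by
    ext u
    constructor
    · rintro ⟨v, ⟨⟨a, b, hab, ha, hb⟩, hv⟩, rfl⟩
      refine ⟨⟨a, b, hab, ha.of_infix ?_, hb.of_infix ?_⟩, by simp [hv]⟩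
      all_goals exact (List.cons_prefix_cons.2 ⟨rfl, List.dropLast_prefix v⟩).isInfix
    · rintro ⟨⟨a, b, hab, ha, hb⟩, hu⟩
      obtain ⟨c, ⟨h1, h2⟩, -⟩ := h.uniqueRight (u := u) (by rintro rfl; simp at hu) a b hab ha hb
      exact ⟨u ++ [c], ⟨⟨a, b, hab, h1, h2⟩, by simp [hu]⟩, by simp⟩
  rw [← himg, Set.InjOn.ncard_image]
  rintro u ⟨⟨a, b, hab, ha, hb⟩, hu⟩ v ⟨⟨a', b', hab', ha', hb'⟩, hv⟩ huv
  obtain ⟨x, c, rfl⟩ := (List.eq_nil_or_concat u).resolve_left (by rintro rfl; simp at hu)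
  obtain ⟨y, d, rfl⟩ := (List.eq_nil_or_concat v).resolve_left (by rintro rfl; simp at hv)
  simp only [List.concat_eq_append, List.dropLast_concat, List.length_append,
    List.length_singleton] at *
  subst huv
  obtain ⟨p, t, rfl⟩ := List.exists_cons_of_ne_nil (l := x) (by rintro rfl; simp at hu)
  -- At most two letters precede any given letter, so both words have the same pair of left
  -- extensions and uniqueness applies to that pair.
  have hpair : (a' = a ∧ b' = b) ∨ (a' = b ∧ b' = a) :=
    (by decide : ∀ p a b a' b', a ≠ b → a' ≠ b' → Adj a p → Adj b p → Adj a' p → Adj b' p →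
      (a' = a ∧ b' = b) ∨ (a' = b ∧ b' = a)) p a b a' b' hab hab' (ha.adj_left h) (hb.adj_left h)
      (ha'.adj_left h) (hb'.adj_left h)
  have huniq := h.uniqueRight (u := p :: t) (by simp) a b hab ha.of_append_right
    hb.of_append_right
  rcases hpair with ⟨rfl, rfl⟩ | ⟨rfl, rfl⟩
  · rw [huniq.unique ⟨ha, hb⟩ ⟨ha', hb'⟩]
  · rw [huniq.unique ⟨ha, hb⟩ ⟨hb', ha'⟩]

theorem ncard_leftSpecial {τ : ℕ → Substitution (Fin 3)} (h : Good τ) (n : ℕ) :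
    (leftSpecial τ (n + 1)).ncard = 2 := by
  induction n with
  | zero => exact ncard_leftSpecial_one h
  | succ n ih => rw [ncard_leftSpecial_succ h, ih]

/-- One left extension `g u` is chosen for each `u`. The longer words not of the form `g u :: u`
correspond by `List.tail` to the left special words, each of which has just one further extension.
-/
theorem ncard_words_succ {τ : ℕ → Substitution (Fin 3)} (h : Good τ) (n : ℕ) :
    (words τ (n + 2)).ncard = (words τ (n + 1)).ncard + (leftSpecial τ (n + 1)).ncard := by
  have hex : ∀ u, ∃ a, Lang τ u → Lang τ (a :: u) := fun u => by
    by_cases hu : Lang τ u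
    · obtain ⟨a, ha⟩ := hu.exists_left h
      exact ⟨a, fun _ => ha⟩
    · exact ⟨0, fun h' => absurd h' hu⟩
  choose g hg using hex
  have hsub : (fun u => g u :: u) '' words τ (n + 1) ⊆ words τ (n + 2) := by
    rintro _ ⟨u, ⟨hu, hl⟩, rfl⟩
    exact ⟨hg u hu, by simp [hl]⟩
  have hB : ∀ a u, a :: u ∈ words τ (n + 2) \ (fun u => g u :: u) '' words τ (n + 1) →
      a ≠ g u ∧ Lang τ (g u :: u) ∧ Lang τ (a :: u) ∧ u.length = n + 1 := by
    rintro a u ⟨⟨hL, hl⟩, hn⟩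
    have hu : Lang τ u := hL.of_infix (List.suffix_cons a u).isInfix
    have hl' : u.length = n + 1 := by simpa using hl
    exact ⟨fun e => hn ⟨u, ⟨hu, hl'⟩, by simp [e]⟩, hg u hu, hL, hl'⟩
  have htail : List.tail '' (words τ (n + 2) \ (fun u => g u :: u) '' words τ (n + 1)) =
      leftSpecial τ (n + 1) := by
    ext u
    constructor
    · rintro ⟨v, hv, rfl⟩
      obtain ⟨a, t, rfl⟩ := List.exists_cons_of_ne_nil (l := v)
        (by rintro rfl; simpa using hv.1.2)
      obtain ⟨h1, h2, h3, h4⟩ := hB a t hv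
      exact ⟨⟨a, g t, h1, h3, h2⟩, h4⟩
    · rintro ⟨⟨a, b, hab, ha, hb⟩, hu⟩
      obtain ⟨d, hd, hdu⟩ : ∃ d, d ≠ g u ∧ Lang τ (d :: u) := by
        by_cases e : a = g u
        · exact ⟨b, fun e' => hab (e.trans e'.symm), hb⟩
        · exact ⟨a, e, ha⟩
      refine ⟨d :: u, ⟨⟨hdu, by simp [hu]⟩, ?_⟩, rfl⟩
      rintro ⟨v, -, hv⟩
      simp only [List.cons.injEq] at hv
      obtain ⟨h1, rfl⟩ := hv
      exact hd h1.symm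
  rw [← Set.ncard_sdiff_add_ncard_of_subset hsub (words_finite τ _), add_comm,
    Set.ncard_image_of_injective, ← htail, Set.InjOn.ncard_image]
  · intro u hu v hv huv
    obtain ⟨a, t, rfl⟩ := List.exists_cons_of_ne_nil (l := u) (by rintro rfl; simpa using hu.1.2)
    obtain ⟨b, t', rfl⟩ := List.exists_cons_of_ne_nil (l := v) (by rintro rfl; simpa using hv.1.2)
    obtain rfl : t = t' := huv
    obtain ⟨h1, h2, h3, h4⟩ := hB a t hu
    obtain ⟨h1', -, h3', -⟩ := hB b t hv
    obtain ⟨p, t, rfl⟩ := List.exists_cons_of_ne_nil (l := t) (by rintro rfl; simp at h4)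
    rw [(by decide : ∀ p a b c, a ≠ c → b ≠ c → Adj a p → Adj b p → Adj c p → a = b) p a b _
      h1 h1' (h3.adj_left h) (h3'.adj_left h) (h2.adj_left h)]
  · intro u v huv
    simp only [List.cons.injEq] at huv
    exact huv.2

theorem Good.ncard_words {τ : ℕ → Substitution (Fin 3)} (h : Good τ) (n : ℕ) :
    (words τ n).ncard = 2 * n + 1 := by
  rcases n with _ | n
  · have : words τ 0 = {[]} := by
      ext u
      simp only [words, Set.mem_ofPred_eq, List.length_eq_zero_iff, Set.mem_singleton_iff,
        and_iff_right_iff_imp]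
      rintro rfl
      exact (lang_singleton τ 0).of_infix (List.nil_infix)
    rw [this, Set.ncard_singleton]
  induction n with
  | zero =>
    have : words τ 1 = (fun a : Fin 3 => [a]) '' Set.univ := by
      ext u
      simp only [words, Set.mem_ofPred_eq, List.length_eq_one_iff, Set.image_univ, Set.mem_range]
      constructor
      · rintro ⟨-, a, rfl⟩
        exact ⟨a, rfl⟩
      · rintro ⟨a, rfl⟩
        exact ⟨lang_singleton τ a, a, rfl⟩
    rw [this, Set.ncard_image_of_injective _ (fun a b hab => by simpa using hab)]
    simp [Set.ncard_univ]
  | succ n ih =>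
    rw [ncard_words_succ h, ih, ncard_leftSpecial h]
    ring

/-! ### Factors of `S`-adic words -/

theorem isFactor_of_infix_takePrefix {A : Type*} {w : ℕ → A} {k : ℕ} {u : List A}
    (h : u <:+: takePrefix w k) : IsFactor w u := by
  obtain ⟨x, y, hxy⟩ := h
  have hk : k = x.length + (u.length + y.length) := by
    have := congrArg List.length hxy
    simp [takePrefix] at this
    omega
  subst hk
  simp only [takePrefix, List.range_add, List.map_append, List.map_map, List.append_assoc] at hxy
  have h1 := (List.append_inj hxy (by simp)).2
  have h2 := (List.append_inj h1 (by simp)).1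
  exact ⟨x.length, h2.symm⟩

theorem IsFactor.infix_takePrefix {A : Type*} {w : ℕ → A} {u : List A} (h : IsFactor w u) :
    ∃ k, u <:+: takePrefix w k := by
  obtain ⟨i, hi⟩ := h
  refine ⟨i + u.length, takePrefix w i, [], ?_⟩
  rw [takePrefix, takePrefix, List.range_add, List.map_append, List.append_nil, List.map_map]
  exact congrArg _ hi.symm

theorem IsSAdicWord.isFactor_iff {τ : ℕ → Substitution (Fin 3)} (h : Good τ) {w : ℕ → Fin 3}
    (hw : IsSAdicWord τ w) (u : List (Fin 3)) : IsFactor w u ↔ Lang τ u := by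
  obtain ⟨a, ha⟩ := hw
  constructor
  · intro hu
    obtain ⟨k, hk⟩ := hu.infix_takePrefix
    obtain ⟨n, hn⟩ := (ha k).exists
    exact ⟨n, a n, hk.trans hn.isInfix⟩
  · intro hu
    obtain ⟨M, hM⟩ := hu.eventually h
    -- The sum bounds the length of every level-`M` image, so the prefix of length `K` contains the
    -- first such image whichever letter it comes from.
    let K := ∑ c, (compose τ M [c]).length
    obtain ⟨n, hn, hMn⟩ := ((ha K).and (eventually_ge_atTop M)).exists
    obtain ⟨k, rfl⟩ := Nat.exists_eq_add_of_le hMn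
    obtain ⟨c, v, hv⟩ := List.exists_cons_of_ne_nil
      (compose_ne_nil (h.drop M).apply_ne_nil k (List.cons_ne_nil (a (M + k)) []))
    have hpre : compose τ M [c] <+: compose τ (M + k) [a (M + k)] := by
      rw [compose_add, hv, show c :: v = [c] ++ v from rfl, compose_append]
      exact List.prefix_append _ _
    have hle : (compose τ M [c]).length ≤ (takePrefix w K).length := by
      rw [takePrefix, List.length_map, List.length_range]
      exact Finset.single_le_sum (f := fun c => (compose τ M [c]).length) (fun _ _ => Nat.zero_le _)
        (Finset.mem_univ c)
    exact isFactor_of_infix_takePrefix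
      ((hM M le_rfl c).trans (List.prefix_of_prefix_length_le hpre hn hle).isInfix)

theorem Good.complexity {τ : ℕ → Substitution (Fin 3)} (h : Good τ) {w : ℕ → Fin 3}
    (hw : IsSAdicWord τ w) (n : ℕ) : complexity w n = 2 * n + 1 := by
  rw [← h.ncard_words n, Selmer.complexity]
  simp only [hw.isFactor_iff h, words]

/-! ### Existence of `S`-adic words -/

theorem exists_letters_of_lt {A : Type*} [Inhabited A] (m : ℕ) :
    ∀ τ : ℕ → Substitution A, (∀ n a, τ n a ≠ []) →
      ∃ a : ℕ → A, ∀ n < m, [a n] <+: τ n (a (n + 1)) := by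
  induction m with
  | zero => exact fun τ _ => ⟨fun _ => default, by simp⟩
  | succ m ih =>
    intro τ hτ
    obtain ⟨b, hb⟩ := ih (shift τ) fun n a => hτ (n + 1) a
    obtain ⟨c, v, hv⟩ := List.exists_cons_of_ne_nil (hτ 0 (b 0))
    refine ⟨fun n => Nat.casesOn n c b, fun n hn => ?_⟩
    rcases n with _ | n
    · exact ⟨v, hv.symm⟩
    · exact hb n (by omega)

/-- Finitely many of the conditions are solved backwards from an arbitrary last letter; compactness
of the product of finite discrete spaces gives all at once. Such letters make the words `compose τ n
[a n]` nested prefixes. -/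
theorem exists_letters {τ : ℕ → Substitution (Fin 3)} (hτ : ∀ n a, τ n a ≠ []) :
    ∃ a : ℕ → Fin 3, ∀ n, [a n] <+: τ n (a (n + 1)) := by
  let K : ℕ → Set (ℕ → Fin 3) := fun m => {a | ∀ n < m, [a n] <+: τ n (a (n + 1))}
  have hclosed : ∀ m, IsClosed (K m) := by
    intro m
    have : K m = ⋂ n, ⋂ _ : n < m,
        (fun a : ℕ → Fin 3 => (a n, a (n + 1))) ⁻¹' {p | [p.1] <+: τ n p.2} := by
      ext a
      simp [K]
    rw [this]
    exact isClosed_iInter fun n => isClosed_iInter fun _ =>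
      (isClosed_discrete _).preimage (by fun_prop)
  obtain ⟨a, ha⟩ := IsCompact.nonempty_iInter_of_sequence_nonempty_isCompact_isClosed K
    (fun m a ha n hn => ha n (by omega)) (fun m => exists_letters_of_lt m τ hτ)
    (hclosed 0).isCompact hclosed
  exact ⟨a, fun n => Set.mem_iInter.1 ha (n + 1) n (by omega)⟩

theorem Good.exists_lang_length {τ : ℕ → Substitution (Fin 3)} (h : Good τ) (k : ℕ) :
    ∃ u, Lang τ u ∧ k ≤ u.length := by
  induction k with
  | zero => exact ⟨[0], lang_singleton τ 0, Nat.zero_le _⟩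
  | succ k ih =>
    obtain ⟨u, hu, hk⟩ := ih
    obtain ⟨a, ha⟩ := hu.exists_left h
    exact ⟨a :: u, ha, by simpa using hk⟩

theorem Good.exists_isSAdicWord {τ : ℕ → Substitution (Fin 3)} (h : Good τ) :
    ∃ w, IsSAdicWord τ w := by
  obtain ⟨a, ha⟩ := exists_letters h.apply_ne_nil
  have hstep : ∀ n, compose τ n [a n] <+: compose τ (n + 1) [a (n + 1)] := by
    intro n
    obtain ⟨v, hv⟩ := ha n
    change _ <+: compose τ n ((τ n).apply [a (n + 1)])
    rw [Substitution.apply_singleton, ← hv, compose_append]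
    exact List.prefix_append _ _
  have hmono : ∀ m n, m ≤ n → compose τ m [a m] <+: compose τ n [a n] := by
    intro m n hmn
    induction n, hmn using Nat.le_induction with
    | base => exact List.prefix_rfl
    | succ n _ ih => exact ih.trans (hstep n)
  have hlen : ∀ k, ∃ M, ∀ m ≥ M, k ≤ (compose τ m [a m]).length := by
    intro k
    obtain ⟨u, hu, hk⟩ := h.exists_lang_length k
    obtain ⟨M, hM⟩ := hu.eventually h
    exact ⟨M, fun m hm => hk.trans (hM m hm (a m)).length_le⟩
  choose M hM using hlen
  have hget : ∀ j m n (hm : j < (compose τ m [a m]).length) (hn : j < (compose τ n [a n]).length),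
      (compose τ m [a m])[j] = (compose τ n [a n])[j] := by
    intro j m n hm hn
    rcases le_total m n with hmn | hmn
    · exact (hmono m n hmn).getElem hm
    · exact ((hmono n m hmn).getElem hn).symm
  refine ⟨fun j => (compose τ (M (j + 1)) [a (M (j + 1))])[j]'(hM (j + 1) _ le_rfl), a, fun k => ?_⟩
  filter_upwards [eventually_ge_atTop (M k)] with n hn
  have hk := hM k n hn
  rw [List.prefix_iff_eq_take]
  refine List.ext_getElem (by simpa [takePrefix] using hk) fun j h1 h2 => ?_
  simp only [takePrefix, List.getElem_map, List.getElem_range, List.getElem_take]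
  exact hget _ _ _ _ _

/-! ### The directive sequence of a totally irrational vector -/

theorem s₁_ne_s₂ : s₁ ≠ s₂ := by decide

theorem iterate_mem_Gamma {x : Fin 3 → ℝ} (hx : x ∈ Gamma) (n : ℕ) : FS^[n] x ∈ Gamma :=
  mapsTo_FS.iterate n hx

theorem linearIndependent_FS {x : Fin 3 → ℝ} (hx : LinearIndependent ℚ x) :
    LinearIndependent ℚ (FS x) := by
  rw [Fintype.linearIndependent_iff] at hx ⊢
  intro g hg
  unfold FS at hg
  simp only [Fin.sum_univ_three] at hx hg
  split_ifs at hg with hle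
  -- The coefficients of `x 0`, `x 1`, `x 2` after expanding the relation among the coordinates of
  -- `FS x`; likewise in the other branch.
  · have := hx ![g 1, g 0, g 2 - g 1] (by
      simp [Rat.smul_def] at hg ⊢
      linarith)
    have h0 := this 0
    have h1 := this 1
    have h2 := this 2
    simp at h0 h1 h2
    intro i
    fin_cases i <;> simp <;> linarith
  · have := hx ![g 2, g 1 - g 2, g 0] (by
      simp [Rat.smul_def] at hg ⊢
      linarith)
    have h0 := this 0
    have h1 := this 1
    have h2 := this 2
    simp at h0 h1 h2
    intro i
    fin_cases i <;> simp <;> linarith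

theorem linearIndependent_iterate_FS {x : Fin 3 → ℝ} (hx : LinearIndependent ℚ x) (n : ℕ) :
    LinearIndependent ℚ (FS^[n] x) := by
  induction n with
  | zero => exact hx
  | succ n ih =>
    rw [Function.iterate_succ_apply']
    exact linearIndependent_FS ih

theorem FS_FS_of_subst_eq {y : Fin 3 → ℝ} (hy : y ∈ Gamma) (h : subst y = subst (FS y)) :
    FS (FS y) 1 + FS (FS y) 2 - FS (FS y) 0 = y 1 + y 2 - y 0 ∧
      FS (FS y) 0 ≤ y 0 - (y 1 + y 2 - y 0) := by
  obtain ⟨-, h1, -⟩ := hy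
  obtain ⟨h1, h2⟩ := max_le_iff.1 h1
  by_cases ha : y 2 ≤ y 1
  · have e : FS y = ![y 1, y 0 - y 2, y 2] := if_pos ha
    rw [e] at h ⊢
    by_cases hb : y 2 ≤ y 0 - y 2
    · rw [FS]
      simp [hb]
      constructor <;> linarith
    · simp [subst, ha, hb, s₁_ne_s₂] at h
  · have e : FS y = ![y 2, y 1, y 0 - y 1] := if_neg ha
    rw [e] at h ⊢
    by_cases hb : y 0 - y 1 ≤ y 1
    · rw [subst, subst, if_neg ha, if_pos (by simpa using hb)] at h
      exact absurd h.symm s₁_ne_s₂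
    · rw [FS, if_neg (by simpa using hb)]
      simp
      constructor <;> linarith

theorem good_directive {x : Fin 3 → ℝ} (hx : x ∈ Gamma) (hirr : LinearIndependent ℚ x) :
    Good (directive x) where
  mem n := by
    unfold directive subst
    split_ifs
    exacts [Or.inl rfl, Or.inr rfl]
  ne n := by
    by_contra! hcon
    let y : ℕ → Fin 3 → ℝ := fun k => FS^[n + 2 * k] x
    have hy : ∀ k, y k ∈ Gamma := fun k => iterate_mem_Gamma hx _
    have hsucc : ∀ k, y (k + 1) = FS (FS (y k)) := fun k => by
      rw [← Function.iterate_succ_apply' FS, ← Function.iterate_succ_apply' FS]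
      rfl
    have hstep : ∀ k, y (k + 1) 1 + y (k + 1) 2 - y (k + 1) 0 = y k 1 + y k 2 - y k 0 ∧
        y (k + 1) 0 ≤ y k 0 - (y k 1 + y k 2 - y k 0) := by
      intro k
      rw [hsucc]
      refine FS_FS_of_subst_eq (hy k) ?_
      have := hcon k
      rwa [directive, directive, Function.iterate_succ_apply'] at this
    set d := y 0 1 + y 0 2 - y 0 0 with hd
    have hmain : ∀ k : ℕ, y k 1 + y k 2 - y k 0 = d ∧ y k 0 ≤ y 0 0 - k * d := by
      intro k
      induction k with
      | zero => simp [hd]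
      | succ k ih =>
        obtain ⟨h1, h2⟩ := hstep k
        refine ⟨h1.trans ih.1, ?_⟩
        rw [ih.1] at h2
        push_cast
        linarith [ih.2]
    -- A positive `d` would be subtracted from the nonnegative first coordinate infinitely often.
    have hd0 : d ≤ 0 := by
      by_contra! hpos
      obtain ⟨k, hk⟩ := exists_nat_gt (y 0 0 / d)
      rw [div_lt_iff₀ hpos] at hk
      linarith [(hmain k).2, (hy k).1 0]
    have hd1 : d = 0 := le_antisymm hd0 (by linarith [(hy 0).2.2])
    have hli := linearIndependent_iterate_FS hirr (n + 2 * 0)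
    rw [Fintype.linearIndependent_iff] at hli
    have := hli ![-1, 1, 1] (by
      simp only [Fin.sum_univ_three]
      simp
      change -y 0 0 + y 0 1 + y 0 2 = 0
      linarith) 0
    simp at this

end Selmer

theorem proposition3 (x : Fin 3 → ℝ) (hx : x ∈ Selmer.Gamma) (hirr : LinearIndependent ℚ x) :
    (∃ w : ℕ → Fin 3, Selmer.IsSAdicWord (Selmer.directive x) w) ∧
      ∀ w : ℕ → Fin 3, Selmer.IsSAdicWord (Selmer.directive x) w →
        ∀ n : ℕ, Selmer.complexity w n = 2 * n + 1 :=
  ⟨(Selmer.good_directive hx hirr).exists_isSAdicWord,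
    fun _ hw n => (Selmer.good_directive hx hirr).complexity hw n⟩
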